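/- **Theorem 1.** Let $\sigma>0$ and consider the memoryless channel $\tilde Y=HX+Z$, where $X,H,Z$ are independent complex random variables, $H$ is circularly-symmetric complex Gaussian with mean $0$ and variance $1$, and $Z$ is circularly-symmetric complex Gaussian with mean $0$ and variance $\sigma^2$. The output passes through a one-bit quantizer: $Y=1$ if $\tilde Y\in\mathcal D$ and $Y=0$ otherwise. In the *coherent* case the receiver knows $H$ and the Borel set $\mathcal D=\mathcal D(H)\subseteq\mathbb C$ may depend (measurably) on $H$; in the *noncoherent* case $\mathcal D\subseteq\mathbb C$ is a fixed Borel set. For $P>0$ let $C(P)=\sup I(X;Y\mid H)$ in the coherent case and $C(P)=\sup I(X;Y)$ in the noncoherent case, the suprema being over all laws of $X$ with $\mathbb E|X|^2\le P$ and over all admissible $\mathcal D$ (information is measured in nats). The capacity per unit-energy is $\dot C(0)=\sup_{P>0}C(P)/P$. A quantizer is *radial* if $\mathcal D=\{\tilde y:|\tilde y|\ge T\}$ with $T>0$. 1. In the coherent case $\dot C(0)=1/\sigma^2$. This value is achieved by radial quantizers: it is unchanged when only quantizers $\mathcal D(H)=\{|\tilde y|\ge T(H)\}$ with measurable $T>0$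 are allowed, and there is a measurable threshold $T=T(h,\xi)>0$ such that, with $\mathcal D(h)=\{|\tilde y|\ge T(h,\xi)\}$, $$\sup_{\xi\in\mathbb C\setminus\{0\}}\frac{D\bigl(P_{Y|H,X=\xi}\,\big\|\,P_{Y|H,X=0}\,\big|\,P_H\bigr)}{|\xi|^2}=\frac1{\sigma^2},$$ where $D(\cdot\|\cdot|P_H)$ is the relative entropy of the conditional output laws given $H=h$, averaged over the law $P_H$ of $H$. 2. In the noncoherent case $\dot C(0)<1/\sigma^2$; in fact $\dot C(0)\le 1/(e\sigma^2)$. Moreover radial quantizers are optimal in the following sense: for every $\xi\ne0$ there is a $T>0$ such that the region $\{|\tilde y|\ge T\}$ maximizes the relative entropy $D(P_{Y|X=\xi}\|P_{Y|X=0})$ among all Borel sets $\mathcal D$. -/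

import Mathlib

open MeasureTheory ProbabilityTheory InformationTheory
open scoped NNReal ENNReal

namespace OneBit

noncomputable section

/-- The circularly-symmetric complex Gaussian law `CN(0, v)`: independent real and imaginary
parts, each a centered real Gaussian of variance `v / 2`. -/
def complexGaussian (v : ℝ≥0) : Measure ℂ :=
  ((gaussianReal 0 (v / 2)).prod (gaussianReal 0 (v / 2))).map
    (fun p : ℝ × ℝ => (⟨p.1, p.2⟩ : ℂ))

/-- The law of the fading `H`: zero-mean, unit variance. -/
def fadingLaw : Measure ℂ := complexGaussian 1

/-- The law of the additive noise `Z`: zero-mean, variance `σ²`. -/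
def noiseLaw (σ : ℝ≥0) : Measure ℂ := complexGaussian (σ ^ 2)

open Classical in
/-- The one-bit quantizer with quantization region `D`: it outputs `true` (the bit `1`) if the
unquantized channel output lies in `D`, and `false` (the bit `0`) otherwise. -/
def quantize (D : Set ℂ) (y : ℂ) : Bool := decide (y ∈ D)

/-- Mutual information (in nats) `I(X;Y)`: the relative entropy of the joint law of `X` and `Y`
with respect to the product of their marginal laws. -/
def mutualInfo {Ω α β : Type*} [MeasurableSpace Ω] [MeasurableSpace α] [MeasurableSpace β]
    (μ : Measure Ω) (X : Ω → α) (Y : Ω → β) : ℝ≥0∞ :=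
  klDiv (μ.map (fun ω => (X ω, Y ω))) ((μ.map X).prod (μ.map Y))

/-- The admissible input laws under the average-power constraint `E |X|² ≤ P`. -/
def inputLaws (P : ℝ≥0) : Set (Measure ℂ) :=
  {μ | IsProbabilityMeasure μ ∧ ∫⁻ x, ‖x‖ₑ ^ 2 ∂μ ≤ (P : ℝ≥0∞)}

/-- The radial quantization region with threshold `T`. -/
def radialRegion (T : ℝ) : Set ℂ := {y | T ≤ ‖y‖}

/-! ### Coherent channel: the quantization region may depend on the fading -/

/-- All quantization rules `h ↦ D h` of the coherent receiver: fading-dependent Borel sets,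
measurable jointly in the fading and the channel output. -/
def coherentRules : Set (ℂ → Set ℂ) :=
  {D | MeasurableSet {p : ℂ × ℂ | p.2 ∈ D p.1}}

/-- The radial quantization rules of the coherent receiver: the (positive) threshold is a
measurable function of the fading. -/
def radialRules : Set (ℂ → Set ℂ) :=
  {D | ∃ T : ℂ → ℝ, Measurable T ∧ (∀ h, 0 < T h) ∧ ∀ h, D h = radialRegion (T h)}

/-- `I(X;Y|H)` for the input law `μ` and the quantization rule `D`, where `X`, `H`, `Z` are
independent and `Y` is the quantized version of `H X + Z`. It is the average over `H` of the
mutual information of `X` and `Y` conditioned on `H = h`. -/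
def coherentInfo (σ : ℝ≥0) (μ : Measure ℂ) (D : ℂ → Set ℂ) : ℝ≥0∞ :=
  ∫⁻ h, mutualInfo (μ.prod (noiseLaw σ)) (fun ω : ℂ × ℂ => ω.1)
    (fun ω : ℂ × ℂ => quantize (D h) (h * ω.1 + ω.2)) ∂fadingLaw

/-- The capacity `C(P)` of the coherent channel when the quantization rule is taken from `𝒟`. -/
def coherentCapacity (σ : ℝ≥0) (𝒟 : Set (ℂ → Set ℂ)) (P : ℝ≥0) : ℝ≥0∞ :=
  ⨆ μ ∈ inputLaws P, ⨆ D ∈ 𝒟, coherentInfo σ μ D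

/-- The capacity per unit-energy `sup_{P > 0} C(P) / P` of the coherent channel when the
quantization rule is taken from `𝒟`. -/
def coherentCapacityPerUnitEnergy (σ : ℝ≥0) (𝒟 : Set (ℂ → Set ℂ)) : ℝ≥0∞ :=
  ⨆ (P : ℝ≥0) (_ : 0 < P), coherentCapacity σ 𝒟 P / (P : ℝ≥0∞)

/-- The law of `Y` given `H = h` and `X = x`, for the quantization region `D`. -/
def coherentOutputLaw (σ : ℝ≥0) (D : Set ℂ) (h x : ℂ) : Measure Bool :=
  (noiseLaw σ).map (fun z => quantize D (h * x + z))

/-- The conditional relative entropy `D(P_{Y|H,X=ξ} ‖ P_{Y|H,X=0} | P_H)`. -/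
def coherentRelEntropy (σ : ℝ≥0) (D : ℂ → Set ℂ) (ξ : ℂ) : ℝ≥0∞ :=
  ∫⁻ h, klDiv (coherentOutputLaw σ (D h) h ξ) (coherentOutputLaw σ (D h) h 0) ∂fadingLaw

/-! ### Noncoherent channel: the quantization region is a fixed Borel set -/

/-- `I(X;Y)` for the input law `μ` and the quantization region `D`, where `X`, `H`, `Z` are
independent and `Y` is the quantized version of `H X + Z`. -/
def noncoherentInfo (σ : ℝ≥0) (μ : Measure ℂ) (D : Set ℂ) : ℝ≥0∞ :=
  mutualInfo (μ.prod (fadingLaw.prod (noiseLaw σ))) (fun ω : ℂ × ℂ × ℂ => ω.1)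
    (fun ω : ℂ × ℂ × ℂ => quantize D (ω.2.1 * ω.1 + ω.2.2))

/-- The capacity `C(P)` of the noncoherent channel. -/
def noncoherentCapacity (σ : ℝ≥0) (P : ℝ≥0) : ℝ≥0∞ :=
  ⨆ μ ∈ inputLaws P, ⨆ (D : Set ℂ) (_ : MeasurableSet D), noncoherentInfo σ μ D

/-- The capacity per unit-energy `sup_{P > 0} C(P) / P` of the noncoherent channel. -/
def noncoherentCapacityPerUnitEnergy (σ : ℝ≥0) : ℝ≥0∞ :=
  ⨆ (P : ℝ≥0) (_ : 0 < P), noncoherentCapacity σ P / (P : ℝ≥0∞)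

/-- The law of `Y` given `X = x`, for the quantization region `D`. -/
def noncoherentOutputLaw (σ : ℝ≥0) (D : Set ℂ) (x : ℂ) : Measure Bool :=
  (fadingLaw.prod (noiseLaw σ)).map (fun ω : ℂ × ℂ => quantize D (ω.1 * x + ω.2))

/-- The relative entropy `D(P_{Y|X=ξ} ‖ P_{Y|X=0})`. -/
def noncoherentRelEntropy (σ : ℝ≥0) (D : Set ℂ) (ξ : ℂ) : ℝ≥0∞ :=
  klDiv (noncoherentOutputLaw σ D ξ) (noncoherentOutputLaw σ D 0)

end

end OneBit

/-!
Everything rests on two facts. The mutual information `I(X;Y)` over a channel with output laws `W_x`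
is at most the average of `D(W_X ‖ W_0)` (`mutualInfo_channel_le`, by the chain rule), and on-off
signaling with vanishing duty cycle attains `D(W_ξ ‖ W_0) / |ξ|²`. So the capacity per unit-energy
is the supremum of `D(W_ξ ‖ W_0) / |ξ|²`, and only binary relative entropies have to be estimated.

*Coherent case.* Given `H = h`, the unquantized output laws are shifted complex Gaussians, with
relative entropy `|h ξ|² / σ²`; data processing and `E |H|² = 1` give the upper bound `1 / σ²`
(`coherentInfo_le`). For the lower bound, take the threshold `|h ξ| - √|h ξ|`. As `|h ξ|` grows,
the region is hit with probability tending to `1` under the input `ξ`, but with probability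
`exp (-T² / σ²)` under the input `0`, where `T² ~ |h ξ|²`; hence the binary relative entropy is
asymptotic to `|h ξ|² / σ²`, and Fatou's lemma averages this over `h`
(`le_iSup_coherentRelEntropy`). A second use of Fatou's lemma passes from the relative entropy to
the capacity (`coherentRelEntropy_div_le`).

*Noncoherent case.* The output given `X = x` is circularly-symmetric Gaussian with variance
`|x|² + σ²`. By the Neyman-Pearson lemma (`complexGaussian_real_le_rpow`), a region of probability
`q` under the input `0` has probability at most `q ^ r` under the input `x`, where
`r = σ² / (|x|² + σ²)`, and the radial region attains this. Binary relative entropy is monotone in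
the distance of its first argument from the second, so passing to the complement if necessary,
every region is dominated by a value `radialDiv r q`. This function is continuous in `q ∈ [0, 1]`
and vanishes at the endpoints, so its maximum is attained by a radial region with positive threshold
(`exists_radialRegion_optimal`). Moreover, with `p = q ^ r`, it is at most
`p log (p / q) = -(1 / r - 1) p log p ≤ (|x|² / σ²) / e`, which bounds the capacity per unit-energy
by `1 / (e σ²) < 1 / σ²`.
-/

open MeasureTheory ProbabilityTheory InformationTheory
open scoped NNReal ENNReal

namespace OneBit

/-! ### Relative entropy and mutual information for a binary output -/

lemma klDiv_withDensity {α : Type*} [MeasurableSpace α] {ν : Measure α} [IsFiniteMeasure ν]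
    {f : α → ℝ≥0∞} (hf : Measurable f) [IsFiniteMeasure (ν.withDensity f)] :
    klDiv (ν.withDensity f) ν = ∫⁻ x, ENNReal.ofReal (klFun (f x).toReal) ∂ν := by
  rw [klDiv_eq_lintegral_klFun_of_ac (withDensity_absolutelyContinuous _ _)]
  refine lintegral_congr_ae ?_
  filter_upwards [Measure.rnDeriv_withDensity ν hf] with x hx
  rw [hx]

/-- On `Bool`, a density is the ratio of the masses of the singletons. -/
lemma withDensity_singleton_ratio {μ ν : Measure Bool} [IsFiniteMeasure ν] (h : μ ≪ ν) :
    ν.withDensity (fun b => μ {b} / ν {b}) = μ := by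
  refine Measure.ext_of_singleton fun b => ?_
  rw [withDensity_apply _ (measurableSet_singleton b), lintegral_singleton]
  by_cases hb : ν {b} = 0
  · simp [hb, h hb]
  · exact ENNReal.div_mul_cancel hb (measure_ne_top _ _)

/-- The relative entropy between the Bernoulli laws with parameters `p` and `q`. For `q ∈ {0, 1}`
this is the relative entropy only if `p = q`. -/
noncomputable def bernoulliDiv (p q : ℝ) : ℝ :=
  q * klFun (p / q) + (1 - q) * klFun ((1 - p) / (1 - q))

lemma bernoulliDiv_symm (p q : ℝ) : bernoulliDiv (1 - p) (1 - q) = bernoulliDiv p q := by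
  simp only [bernoulliDiv, sub_sub_cancel]
  ring

lemma measurable_bernoulliDiv : Measurable fun x : ℝ × ℝ => bernoulliDiv x.1 x.2 := by
  unfold bernoulliDiv
  fun_prop

lemma klDiv_bool {μ ν : Measure Bool} [IsProbabilityMeasure μ] [IsProbabilityMeasure ν]
    (h : μ ≪ ν) :
    klDiv μ ν = ENNReal.ofReal (bernoulliDiv (μ.real {true}) (ν.real {true})) := by
  have hfin : IsFiniteMeasure (ν.withDensity fun b => μ {b} / ν {b}) := by
    rw [withDensity_singleton_ratio h]; infer_instance
  have hc (ρ : Measure Bool) [IsProbabilityMeasure ρ] : ρ.real {false} = 1 - ρ.real {true} := by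
    rw [← probReal_compl_eq_one_sub (measurableSet_singleton true)]
    congr 1
    ext b; cases b <;> simp
  have key := klDiv_withDensity (ν := ν) (f := fun b => μ {b} / ν {b}) (measurable_of_finite _)
  rw [withDensity_singleton_ratio h] at key
  rw [key, lintegral_fintype, Fintype.sum_bool, bernoulliDiv, ENNReal.ofReal_add
    (mul_nonneg measureReal_nonneg (klFun_nonneg (by positivity)))
    (by rw [← hc, ← hc]; exact mul_nonneg measureReal_nonneg (klFun_nonneg (by positivity)))]
  rw [← hc, ← hc, ENNReal.ofReal_mul measureReal_nonneg, ENNReal.ofReal_mul measureReal_nonneg]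
  simp only [measureReal_def, ENNReal.toReal_div]
  rw [ENNReal.ofReal_toReal (measure_ne_top _ _), ENNReal.ofReal_toReal (measure_ne_top _ _),
    mul_comm, mul_comm (ν {false})]

/-- The mutual information is bounded by the relative entropy of the joint law with respect to any
product law with the correct first marginal: by the chain rule, the difference is the relative
entropy of the second marginal with respect to the second factor. -/
lemma mutualInfo_le_klDiv {Ω α β : Type*} [MeasurableSpace Ω] [MeasurableSpace α]
    [MeasurableSpace β] [StandardBorelSpace α] [Nonempty α]
    {P : Measure Ω} [IsProbabilityMeasure P] {X : Ω → α} {Y : Ω → β}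
    (hX : Measurable X) (hY : Measurable Y) (ν : Measure β) [IsProbabilityMeasure ν] :
    mutualInfo P X Y ≤ klDiv (P.map fun ω => (X ω, Y ω)) ((P.map X).prod ν) := by
  have := Measure.isProbabilityMeasure_map (μ := P) hX.aemeasurable
  have := Measure.isProbabilityMeasure_map (μ := P) hY.aemeasurable
  have := Measure.isProbabilityMeasure_map (μ := P) (hX.prodMk hY).aemeasurable
  have := Measure.isProbabilityMeasure_map (μ := P) (hY.prodMk hX).aemeasurable
  set R := P.map fun ω => (Y ω, X ω) with hR
  have hfst : R.fst = P.map Y := by rw [hR, Measure.fst_map_prodMk hX]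
  have hswap : (P.map fun ω => (X ω, Y ω)) = R.map Prod.swap := by
    rw [hR, Measure.map_map measurable_swap (hY.prodMk hX)]; rfl
  have hswap' : (P.map fun ω => (X ω, Y ω)).map Prod.swap = R := by
    rw [hR, Measure.map_map measurable_swap (hX.prodMk hY)]; rfl
  have hdis : P.map Y ⊗ₘ R.condKernel = R := by rw [← hfst]; exact R.disintegrate _
  calc mutualInfo P X Y
      = klDiv (R.map Prod.swap) (((P.map Y).prod (P.map X)).map Prod.swap) := by
        rw [mutualInfo, hswap, Measure.prod_swap]
    _ ≤ klDiv R ((P.map Y).prod (P.map X)) := klDiv_map_le _ _ measurable_swap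
    _ ≤ klDiv (P.map Y) ν + klDiv R ((P.map Y).prod (P.map X)) := le_add_self
    _ = klDiv R (ν.prod (P.map X)) := by
        have := klDiv_compProd_eq_add (P.map Y) ν R.condKernel (Kernel.const β (P.map X))
        rw [Measure.compProd_const, Measure.compProd_const, hdis] at this
        exact this.symm
    _ = klDiv ((P.map fun ω => (X ω, Y ω)).map Prod.swap) (((P.map X).prod ν).map Prod.swap) := by
        rw [hswap', Measure.prod_swap]
    _ ≤ _ := klDiv_map_le _ _ measurable_swap

section Channel

variable {α Z : Type*} [MeasurableSpace α] [MeasurableSpace Z]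
  {μ : Measure α} {ρ : Measure Z} [IsProbabilityMeasure ρ]
  {F : α × Z → Bool}

lemma measurable_channel_density (hF : Measurable F) (Q : Measure Bool) :
    Measurable fun p : α × Bool => ρ.map (fun z => F (p.1, z)) {p.2} / Q {p.2} := by
  have hFx (x : α) : Measurable fun z => F (x, z) := hF.comp measurable_prodMk_left
  have hm (b : Bool) : Measurable fun x => ρ.map (fun z => F (x, z)) {b} := by
    simp_rw [Measure.map_apply (hFx _) (measurableSet_singleton b)]
    exact measurable_measure_prodMk_left (hF (measurableSet_singleton b))
  have h (b : Bool) : Measurable fun x => ρ.map (fun z => F (x, z)) {b} / Q {b} :=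
    (hm b).div_const _
  exact measurable_from_prod_countable_left
    (f := fun p : α × Bool => ρ.map (fun z => F (p.1, z)) {p.2} / Q {p.2}) h

lemma map_channel_eq_withDensity (hF : Measurable F) {Q : Measure Bool} [IsProbabilityMeasure Q]
    (hQ : ∀ x, ρ.map (fun z => F (x, z)) ≪ Q) :
    (μ.prod ρ).map (fun ω => (ω.1, F ω)) =
      (μ.prod Q).withDensity (fun p => ρ.map (fun z => F (p.1, z)) {p.2} / Q {p.2}) := by
  have hFx (x : α) : Measurable fun z => F (x, z) := hF.comp measurable_prodMk_left
  have hd := measurable_channel_density (ρ := ρ) hF Q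
  ext S hS
  rw [Measure.map_apply (measurable_fst.prodMk hF) hS,
    Measure.prod_apply ((measurable_fst.prodMk hF) hS), withDensity_apply _ hS,
    ← lintegral_indicator hS, lintegral_prod _ (hd.indicator hS).aemeasurable]
  refine lintegral_congr fun x => ?_
  have hSx : MeasurableSet (Prod.mk x ⁻¹' S) := measurable_prodMk_left hS
  rw [show Prod.mk x ⁻¹' ((fun ω : α × Z => (ω.1, F ω)) ⁻¹' S) =
      (fun z => F (x, z)) ⁻¹' (Prod.mk x ⁻¹' S) from rfl,
    ← Measure.map_apply (hFx x) hSx]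
  conv_lhs => rw [← withDensity_singleton_ratio (hQ x)]
  rw [withDensity_apply _ hSx, ← lintegral_indicator hSx]
  rfl

/-- For a memoryless channel with binary output, the relative entropy of the joint law with respect
to a product law is the average of the relative entropies of the conditional output laws. -/
lemma klDiv_channel [IsProbabilityMeasure μ] (hF : Measurable F) {Q : Measure Bool}
    [IsProbabilityMeasure Q] (hQ : ∀ x, ρ.map (fun z => F (x, z)) ≪ Q) :
    klDiv ((μ.prod ρ).map (fun ω => (ω.1, F ω))) (μ.prod Q) =
      ∫⁻ x, klDiv (ρ.map (fun z => F (x, z))) Q ∂μ := by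
  have hFx (x : α) : Measurable fun z => F (x, z) := hF.comp measurable_prodMk_left
  have hd := measurable_channel_density (ρ := ρ) hF Q
  have hfin : IsProbabilityMeasure ((μ.prod ρ).map fun ω => (ω.1, F ω)) :=
    Measure.isProbabilityMeasure_map (measurable_fst.prodMk hF).aemeasurable
  rw [map_channel_eq_withDensity hF hQ] at hfin ⊢
  rw [klDiv_withDensity hd]
  refine (lintegral_prod _
    (measurable_klFun.comp hd.ennreal_toReal).ennreal_ofReal.aemeasurable).trans ?_
  refine lintegral_congr fun x => ?_
  have := Measure.isProbabilityMeasure_map (μ := ρ) (hFx x).aemeasurable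
  have hfin' : IsFiniteMeasure
      (Q.withDensity fun b => ρ.map (fun z => F (x, z)) {b} / Q {b}) := by
    rw [withDensity_singleton_ratio (hQ x)]; infer_instance
  refine (klDiv_withDensity (measurable_of_finite _)).symm.trans ?_
  rw [withDensity_singleton_ratio (hQ x)]

/-- Upper bound on the mutual information over a binary-output channel by the average relative
entropy with respect to an arbitrary reference output law. -/
lemma mutualInfo_channel_le [IsProbabilityMeasure μ] [StandardBorelSpace α] [Nonempty α]
    (hF : Measurable F) {Q : Measure Bool} [IsProbabilityMeasure Q]
    (hQ : ∀ x, ρ.map (fun z => F (x, z)) ≪ Q) :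
    mutualInfo (μ.prod ρ) (fun ω => ω.1) F ≤ ∫⁻ x, klDiv (ρ.map (fun z => F (x, z))) Q ∂μ := by
  refine (mutualInfo_le_klDiv measurable_fst hF Q).trans_eq ?_
  rw [← klDiv_channel hF hQ]
  congr 2
  exact Measure.map_fst_prod.trans (by simp)

/-- An output symbol that is possible for one input is possible for all of them, hence has positive
probability under the output law. -/
lemma channel_absolutelyContinuous_output [SFinite μ] (hμ : μ ≠ 0) (hF : Measurable F)
    (hac : ∀ x y, ρ.map (fun z => F (x, z)) ≪ ρ.map (fun z => F (y, z))) (x : α) :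
    ρ.map (fun z => F (x, z)) ≪ (μ.prod ρ).map F := by
  have : (ae μ).NeBot := ae_neBot.2 hμ
  refine fun s => fun h => ?_
  have hs : MeasurableSet s := s.to_countable.measurableSet
  rw [Measure.map_apply hF hs, Measure.measure_prod_null (hF hs)] at h
  obtain ⟨y, hy⟩ := h.exists
  refine hac x y ?_
  exact (Measure.map_apply (hF.comp measurable_prodMk_left) hs).trans hy

/-- The mutual information is the average relative entropy between the conditional output laws and
the output law. -/
lemma mutualInfo_channel [IsProbabilityMeasure μ] (hF : Measurable F)
    (hac : ∀ x y, ρ.map (fun z => F (x, z)) ≪ ρ.map (fun z => F (y, z))) :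
    mutualInfo (μ.prod ρ) (fun ω => ω.1) F =
      ∫⁻ x, klDiv (ρ.map (fun z => F (x, z))) ((μ.prod ρ).map F) ∂μ := by
  have := Measure.isProbabilityMeasure_map (μ := μ.prod ρ) hF.aemeasurable
  rw [← klDiv_channel hF (channel_absolutelyContinuous_output (NeZero.ne μ) hF hac), mutualInfo]
  congr 2
  exact Measure.map_fst_prod.trans (by simp)

end Channel

/-! ### The circularly-symmetric complex Gaussian law -/

lemma measurable_complex_mk : Measurable fun p : ℝ × ℝ => (⟨p.1, p.2⟩ : ℂ) :=
  Complex.measurableEquivRealProd.symm.measurable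

instance (v : ℝ≥0) : IsProbabilityMeasure (complexGaussian v) :=
  Measure.isProbabilityMeasure_map measurable_complex_mk.aemeasurable

instance : IsProbabilityMeasure fadingLaw := by unfold fadingLaw; infer_instance

instance (σ : ℝ≥0) : IsProbabilityMeasure (noiseLaw σ) := by unfold noiseLaw; infer_instance

/-- The density of `complexGaussian v` with respect to Lebesgue measure. -/
noncomputable def complexGaussianPDF (v : ℝ≥0) (z : ℂ) : ℝ :=
  (Real.pi * v)⁻¹ * Real.exp (-‖z‖ ^ 2 / v)

lemma measurable_complexGaussianPDF (v : ℝ≥0) : Measurable (complexGaussianPDF v) := by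
  unfold complexGaussianPDF; fun_prop

lemma complexGaussianPDF_pos {v : ℝ≥0} (hv : v ≠ 0) (z : ℂ) : 0 < complexGaussianPDF v z := by
  have : (0 : ℝ) < v := by positivity
  unfold complexGaussianPDF; positivity

lemma complexGaussian_eq_withDensity {v : ℝ≥0} (hv : v ≠ 0) :
    complexGaussian v = volume.withDensity fun z => ENNReal.ofReal (complexGaussianPDF v z) := by
  have hv2 : v / 2 ≠ 0 := by simpa using hv
  have hv' : (0 : ℝ) < v := by positivity
  have hmp := Complex.volume_preserving_equiv_real_prod.symm
  ext s hs
  have hs' := measurable_complex_mk hs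
  rw [complexGaussian, Measure.map_apply measurable_complex_mk hs,
    gaussianReal_of_var_ne_zero _ hv2,
    prod_withDensity (measurable_gaussianPDF _ _) (measurable_gaussianPDF _ _),
    withDensity_apply _ hs', withDensity_apply _ hs,
    ← hmp.setLIntegral_comp_preimage_emb Complex.measurableEquivRealProd.symm.measurableEmbedding]
  refine lintegral_congr fun p => ?_
  rw [gaussianPDF, gaussianPDF, ← ENNReal.ofReal_mul (gaussianPDFReal_nonneg _ _ _)]
  congr 1
  have h1 : ‖(⟨p.1, p.2⟩ : ℂ)‖ ^ 2 = p.1 ^ 2 + p.2 ^ 2 := by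
    rw [← Complex.normSq_eq_norm_sq, Complex.normSq_mk]; ring
  simp only [gaussianPDFReal, complexGaussianPDF, Complex.measurableEquivRealProd_symm_apply, h1]
  rw [mul_mul_mul_comm, ← Real.exp_add, ← mul_inv, Real.mul_self_sqrt (by positivity)]
  push_cast
  congr 2
  · field_simp
  · field_simp; ring

lemma charFun_complexGaussian (v : ℝ≥0) (t : ℂ) :
    charFun (complexGaussian v) t = Complex.exp (-(v * ‖t‖ ^ 2 / 4)) := by
  have h1 : ‖t‖ ^ 2 = t.re ^ 2 + t.im ^ 2 := by
    rw [← Complex.normSq_eq_norm_sq, Complex.normSq_apply]; ring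
  have h (p : ℝ × ℝ) : Complex.exp ((inner ℝ (⟨p.1, p.2⟩ : ℂ) t : ℝ) * Complex.I) =
      Complex.exp (t.re * p.1 * Complex.I) * Complex.exp (t.im * p.2 * Complex.I) := by
    rw [← Complex.exp_add]
    congr 1
    simp [Complex.inner]
    ring
  rw [charFun_apply, complexGaussian, integral_map measurable_complex_mk.aemeasurable
    (by fun_prop)]
  simp_rw [h]
  rw [integral_prod_mul (fun x : ℝ => Complex.exp (t.re * x * Complex.I))
    (fun x : ℝ => Complex.exp (t.im * x * Complex.I)), ← charFun_apply_real, ← charFun_apply_real,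
    charFun_gaussianReal, charFun_gaussianReal, ← Complex.exp_add]
  congr 1
  rw [← Complex.ofReal_pow ‖t‖, h1]
  push_cast
  ring

/-- A complex multiple of a circularly-symmetric Gaussian plus an independent one is again
circularly-symmetric Gaussian. -/
lemma map_mul_add_complexGaussian (a b : ℝ≥0) (x : ℂ) :
    ((complexGaussian a).prod (complexGaussian b)).map (fun ω : ℂ × ℂ => ω.1 * x + ω.2) =
      complexGaussian (a * ‖x‖₊ ^ 2 + b) := by
  have hm : Measurable fun ω : ℂ × ℂ => ω.1 * x + ω.2 := by fun_prop
  have := Measure.isProbabilityMeasure_map (μ := (complexGaussian a).prod (complexGaussian b))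
    hm.aemeasurable
  refine Measure.ext_of_charFun ?_
  ext t
  have h (ω : ℂ × ℂ) : Complex.exp ((inner ℝ (ω.1 * x + ω.2) t : ℝ) * Complex.I) =
      Complex.exp ((inner ℝ ω.1 (star x * t) : ℝ) * Complex.I) *
        Complex.exp ((inner ℝ ω.2 t : ℝ) * Complex.I) := by
    rw [← Complex.exp_add]
    congr 1
    simp [Complex.inner]
    ring
  rw [charFun_apply, integral_map hm.aemeasurable (by fun_prop)]
  simp_rw [h]
  rw [integral_prod_mul (fun z : ℂ => Complex.exp ((inner ℝ z (star x * t) : ℝ) * Complex.I))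
    (fun z : ℂ => Complex.exp ((inner ℝ z t : ℝ) * Complex.I)), ← charFun_apply, ← charFun_apply,
    charFun_complexGaussian, charFun_complexGaussian, charFun_complexGaussian, ← Complex.exp_add]
  congr 1
  simp
  ring

lemma lintegral_norm_sq_complexGaussian (v : ℝ≥0) :
    ∫⁻ z, ‖z‖ₑ ^ 2 ∂complexGaussian v = v := by
  have hm : ∫⁻ x, ENNReal.ofReal (x ^ 2) ∂gaussianReal 0 (v / 2) = (v / 2 : ℝ≥0) := by
    rw [← ofReal_integral_eq_lintegral_ofReal]
    · have h1 : ∫ x, x ^ 2 ∂gaussianReal 0 (v / 2) = (v / 2 : ℝ≥0) := by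
        have := variance_fun_id_gaussianReal (μ := 0) (v := v / 2)
        rw [variance_eq_integral (by fun_prop)] at this
        simpa using this
      rw [h1, ENNReal.ofReal_coe_nnreal]
    · exact (memLp_id_gaussianReal 2).integrable_sq
    · exact Filter.Eventually.of_forall fun x => sq_nonneg x
  have h (p : ℝ × ℝ) : ‖(⟨p.1, p.2⟩ : ℂ)‖ₑ ^ 2 =
      ENNReal.ofReal (p.1 ^ 2) + ENNReal.ofReal (p.2 ^ 2) := by
    rw [← ofReal_norm, ← ENNReal.ofReal_pow (norm_nonneg _),
      ← ENNReal.ofReal_add (sq_nonneg _) (sq_nonneg _), ← Complex.normSq_eq_norm_sq,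
      Complex.normSq_mk]
    ring_nf
  rw [complexGaussian, lintegral_map (by fun_prop) measurable_complex_mk]
  simp_rw [h]
  rw [lintegral_add_left (by fun_prop), lintegral_prod _ (by fun_prop),
    lintegral_prod _ (by fun_prop)]
  simp only [lintegral_const, measure_univ, mul_one, hm]
  rw [← ENNReal.coe_add, add_halves]

/-- The squared modulus of a circularly-symmetric Gaussian is exponentially distributed. -/
lemma complexGaussian_radialRegion {v : ℝ≥0} (hv : v ≠ 0) {T : ℝ} (hT : 0 ≤ T) :
    complexGaussian v (radialRegion T) = ENNReal.ofReal (Real.exp (-T ^ 2 / v)) := by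
  have hv' : (0 : ℝ) < v := by positivity
  have hS : MeasurableSet (radialRegion T) := measurableSet_le measurable_const measurable_norm
  have hder (r : ℝ) : HasDerivAt (fun r => -((2 * Real.pi)⁻¹ * Real.exp (-r ^ 2 / v)))
      (r * ((Real.pi * v)⁻¹ * Real.exp (-r ^ 2 / v))) r := by
    convert! ((((hasDerivAt_pow 2 r).neg.div_const (v : ℝ)).exp).const_mul
      ((2 * Real.pi)⁻¹)).neg using 1
    simp
    field_simp
  have hlim : Filter.Tendsto (fun r : ℝ => -((2 * Real.pi)⁻¹ * Real.exp (-r ^ 2 / v)))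
      Filter.atTop (nhds (-((2 * Real.pi)⁻¹ * 0))) := by
    refine ((Real.tendsto_exp_atBot.comp ?_).const_mul _).neg
    simp_rw [neg_div]
    exact Filter.tendsto_neg_atTop_atBot.comp
      ((Filter.tendsto_pow_atTop two_ne_zero).atTop_div_const hv')
  have hnn : ∀ r ∈ Set.Ioi T, 0 ≤ r * ((Real.pi * v)⁻¹ * Real.exp (-r ^ 2 / v)) := fun r hr => by
    have : 0 < r := hT.trans_lt hr
    positivity
  have hint := integral_Ioi_of_hasDerivAt_of_nonneg' (fun r _ => hder r) hnn hlim
  have hintg := integrableOn_Ioi_deriv_of_nonneg' (fun r _ => hder r) hnn hlim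
  rw [complexGaussian_eq_withDensity hv, withDensity_apply _ hS, ← lintegral_indicator hS,
    ← Complex.lintegral_comp_polarCoord_symm]
  have hpt (p : ℝ × ℝ) (hp : p ∈ polarCoord.target) :
      ENNReal.ofReal p.1 • (radialRegion T).indicator
        (fun z => ENNReal.ofReal (complexGaussianPDF v z)) (Complex.polarCoord.symm p) =
      (Set.Ici T).indicator (fun r => ENNReal.ofReal
        (r * ((Real.pi * v)⁻¹ * Real.exp (-r ^ 2 / v)))) p.1 * 1 := by
    have h0 : 0 < p.1 := hp.1
    have hn : ‖Complex.polarCoord.symm p‖ = p.1 := by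
      rw [Complex.norm_polarCoord_symm, abs_of_pos h0]
    by_cases h : T ≤ p.1
    · have hmem : Complex.polarCoord.symm p ∈ radialRegion T := h.trans_eq hn.symm
      rw [Set.indicator_of_mem hmem,
        Set.indicator_of_mem (Set.mem_Ici.2 h),
        complexGaussianPDF, hn, smul_eq_mul, ← ENNReal.ofReal_mul h0.le, mul_one]
    · have hmem : Complex.polarCoord.symm p ∉ radialRegion T := fun h' =>
        h (h'.trans_eq hn)
      rw [Set.indicator_of_notMem hmem,
        Set.indicator_of_notMem (by simpa using h)]
      simp
  rw [setLIntegral_congr_fun (by exact polarCoord.open_target.measurableSet) hpt,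
    polarCoord_target, Measure.volume_eq_prod, ← Measure.prod_restrict,
    lintegral_prod_mul (f := (Set.Ici T).indicator fun r => ENNReal.ofReal
      (r * ((Real.pi * v)⁻¹ * Real.exp (-r ^ 2 / v)))) (g := fun _ => 1)
      ((by fun_prop : Measurable fun r : ℝ => ENNReal.ofReal
        (r * ((Real.pi * v)⁻¹ * Real.exp (-r ^ 2 / v)))).indicator measurableSet_Ici).aemeasurable
      (by fun_prop), lintegral_indicator measurableSet_Ici,
    Measure.restrict_restrict measurableSet_Ici]
  have hIoi : ∫⁻ r in Set.Ici T ∩ Set.Ioi 0,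
      ENNReal.ofReal (r * ((Real.pi * v)⁻¹ * Real.exp (-r ^ 2 / v))) =
      ENNReal.ofReal ((2 * Real.pi)⁻¹ * Real.exp (-T ^ 2 / v)) := by
    have hae : (Set.Ici T ∩ Set.Ioi 0 : Set ℝ) =ᵐ[volume] Set.Ioi T := by
      have h1 : (Set.Ici T : Set ℝ) =ᵐ[volume] Set.Ioi T := Ioi_ae_eq_Ici.symm
      have h2 := h1.inter (Filter.EventuallyEq.refl (ae volume) (Set.Ioi (0 : ℝ)))
      rwa [Set.Ioi_inter_Ioi, sup_eq_left.2 hT] at h2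
    rw [setLIntegral_congr hae, ← ofReal_integral_eq_lintegral_ofReal hintg
      ((ae_restrict_iff' measurableSet_Ioi).2 (Filter.Eventually.of_forall hnn)), hint]
    simp
  rw [hIoi]
  simp only [lintegral_const, one_mul, Measure.restrict_apply MeasurableSet.univ, Set.univ_inter,
    Real.volume_Ioo]
  rw [← ENNReal.ofReal_mul (by positivity)]
  congr 1
  field_simp
  ring

lemma volume_absolutelyContinuous_complexGaussian {v : ℝ≥0} (hv : v ≠ 0) :
    volume ≪ complexGaussian v := by
  rw [complexGaussian_eq_withDensity hv]
  refine withDensity_absolutelyContinuous' (by have := measurable_complexGaussianPDF v; fun_prop) ?_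
  exact Filter.Eventually.of_forall fun z => by simpa using complexGaussianPDF_pos hv z

lemma complexGaussian_absolutelyContinuous_volume {v : ℝ≥0} (hv : v ≠ 0) :
    complexGaussian v ≪ volume := by
  rw [complexGaussian_eq_withDensity hv]
  exact withDensity_absolutelyContinuous _ _

lemma map_add_complexGaussian {v : ℝ≥0} (hv : v ≠ 0) (m : ℂ) :
    (complexGaussian v).map (m + ·) = (complexGaussian v).withDensity fun z =>
      ENNReal.ofReal (Real.exp ((2 * inner ℝ m z - ‖m‖ ^ 2) / v)) := by
  have hm := measurable_complexGaussianPDF v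
  have hv' : (0 : ℝ) < v := by positivity
  have hd : Measurable fun z : ℂ =>
      ENNReal.ofReal (Real.exp ((2 * inner ℝ m z - ‖m‖ ^ 2) / v)) := by fun_prop
  ext s hs
  have hs' : MeasurableSet ((m + ·) ⁻¹' s) := (measurable_const_add m) hs
  rw [Measure.map_apply (measurable_const_add m) hs, complexGaussian_eq_withDensity hv,
    ← withDensity_mul _ (by fun_prop) hd, withDensity_apply _ hs', withDensity_apply _ hs,
    ← lintegral_indicator hs, ← lintegral_indicator hs']
  conv_rhs => rw [← lintegral_add_left_eq_self _ m]
  refine lintegral_congr fun z => ?_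
  by_cases hz : m + z ∈ s
  · rw [Set.indicator_of_mem hz, Set.indicator_of_mem (by exact hz), Pi.mul_apply,
      ← ENNReal.ofReal_mul (complexGaussianPDF_pos hv _).le]
    congr 1
    rw [complexGaussianPDF, complexGaussianPDF, mul_assoc, ← Real.exp_add, norm_add_sq_real,
      inner_add_right, real_inner_self_eq_norm_sq]
    congr 2
    field_simp
    ring
  · rw [Set.indicator_of_notMem hz, Set.indicator_of_notMem (by exact hz)]

lemma integrable_inner_complexGaussian (v : ℝ≥0) (m : ℂ) :
    Integrable (fun z => inner ℝ m z) (complexGaussian v) := by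
  rw [complexGaussian, integrable_map_measure (by fun_prop) measurable_complex_mk.aemeasurable]
  have h1 : Integrable (fun x : ℝ => x) (gaussianReal 0 (v / 2)) :=
    (memLp_id_gaussianReal 1).integrable le_rfl
  have h2 := ((h1.comp_fst (gaussianReal 0 (v / 2))).const_mul m.re).add
    ((h1.comp_snd (gaussianReal 0 (v / 2))).const_mul m.im)
  refine h2.congr (Filter.Eventually.of_forall fun p => ?_)
  simp [Complex.inner]
  ring

lemma integral_inner_complexGaussian (v : ℝ≥0) (m : ℂ) :
    ∫ z, inner ℝ m z ∂complexGaussian v = 0 := by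
  have h1 : Integrable (fun x : ℝ => x) (gaussianReal 0 (v / 2)) :=
    (memLp_id_gaussianReal 1).integrable le_rfl
  have h (p : ℝ × ℝ) : inner ℝ m (⟨p.1, p.2⟩ : ℂ) = m.re * p.1 + m.im * p.2 := by
    simp [Complex.inner]
    ring
  rw [complexGaussian, integral_map measurable_complex_mk.aemeasurable (by fun_prop)]
  simp_rw [h]
  rw [integral_add ((h1.comp_fst _).const_mul _) ((h1.comp_snd _).const_mul _),
    integral_const_mul, integral_const_mul, integral_fun_fst (fun x : ℝ => x),
    integral_fun_snd (fun x : ℝ => x), integral_id_gaussianReal]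
  simp

/-- The relative entropy between a shifted complex Gaussian law and the centered one. -/
lemma klDiv_map_add_complexGaussian {v : ℝ≥0} (hv : v ≠ 0) (m : ℂ) :
    klDiv ((complexGaussian v).map (m + ·)) (complexGaussian v) =
      ENNReal.ofReal (‖m‖ ^ 2 / v) := by
  have hd : Measurable fun z : ℂ =>
      ENNReal.ofReal (Real.exp ((2 * inner ℝ m z - ‖m‖ ^ 2) / v)) := by fun_prop
  have hprob : IsProbabilityMeasure ((complexGaussian v).map (m + ·)) :=
    Measure.isProbabilityMeasure_map (by fun_prop)
  have hac : (complexGaussian v).map (m + ·) ≪ complexGaussian v := by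
    rw [map_add_complexGaussian hv]; exact withDensity_absolutelyContinuous _ _
  have hllr : llr ((complexGaussian v).map (m + ·)) (complexGaussian v)
      =ᵐ[(complexGaussian v).map (m + ·)] fun z => (2 * inner ℝ m z - ‖m‖ ^ 2) / v := by
    refine hac.ae_le ?_
    rw [map_add_complexGaussian hv]
    filter_upwards [Measure.rnDeriv_withDensity (complexGaussian v) hd] with z hz
    rw [llr, hz, ENNReal.toReal_ofReal (Real.exp_pos _).le, Real.log_exp]
  have hcomp (z : ℂ) : (2 * inner ℝ m (m + z) - ‖m‖ ^ 2) / v =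
      2 / v * inner ℝ m z + ‖m‖ ^ 2 / v := by
    rw [inner_add_right, real_inner_self_eq_norm_sq]; ring
  have hI := (integrable_inner_complexGaussian v m).const_mul (2 / (v : ℝ))
  have hint : Integrable (llr ((complexGaussian v).map (m + ·)) (complexGaussian v))
      ((complexGaussian v).map (m + ·)) := by
    rw [integrable_congr hllr, integrable_map_measure (by fun_prop) (by fun_prop)]
    refine (hI.add (integrable_const (‖m‖ ^ 2 / (v : ℝ)))).congr
      (Filter.Eventually.of_forall fun z => ?_)
    exact (hcomp z).symm
  rw [klDiv_of_ac_of_integrable hac hint, integral_congr_ae hllr,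
    integral_map (by fun_prop) (by fun_prop)]
  simp_rw [hcomp]
  rw [integral_add hI (integrable_const _), integral_const_mul, integral_inner_complexGaussian]
  simp

/-! ### The quantizer -/

lemma quantize_preimage_true (D : Set ℂ) : quantize D ⁻¹' {true} = D := by
  ext y; simp [quantize]

lemma measurable_quantize {D : Set ℂ} (hD : MeasurableSet D) : Measurable (quantize D) :=
  measurable_to_bool (by rwa [quantize_preimage_true])

lemma measurableSet_radialRegion (T : ℝ) : MeasurableSet (radialRegion T) :=
  measurableSet_le measurable_const measurable_norm

/-! ### Binary relative entropy -/

lemma monotoneOn_klFun : MonotoneOn klFun (Set.Ici 1) := by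
  refine monotoneOn_of_deriv_nonneg (convex_Ici 1) continuous_klFun.continuousOn
    (fun x hx => ?_) fun x hx => ?_
  all_goals rw [interior_Ici] at hx; have hx1 : (1 : ℝ) < x := hx
  · exact (hasDerivAt_klFun (by linarith)).differentiableAt.differentiableWithinAt
  · rw [deriv_klFun]; exact Real.log_nonneg hx1.le

lemma antitoneOn_klFun : AntitoneOn klFun (Set.Icc 0 1) := by
  refine antitoneOn_of_deriv_nonpos (convex_Icc 0 1) continuous_klFun.continuousOn
    (fun x hx => ?_) fun x hx => ?_
  all_goals rw [interior_Icc] at hx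
  · exact (hasDerivAt_klFun hx.1.ne').differentiableAt.differentiableWithinAt
  · rw [deriv_klFun]; exact Real.log_nonpos hx.1.le hx.2.le

lemma bernoulliDiv_mono {p p' q : ℝ} (hq0 : 0 < q) (hq1 : q < 1) (hqp : q ≤ p) (hpp : p ≤ p')
    (hp1 : p' ≤ 1) : bernoulliDiv p q ≤ bernoulliDiv p' q := by
  have hq1' : 0 < 1 - q := by linarith
  refine add_le_add (mul_le_mul_of_nonneg_left (monotoneOn_klFun ?_ ?_ ?_) hq0.le)
    (mul_le_mul_of_nonneg_left (antitoneOn_klFun ⟨?_, ?_⟩ ⟨?_, ?_⟩ ?_) hq1'.le)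
  · exact (one_le_div hq0).2 hqp
  · exact (one_le_div hq0).2 (hqp.trans hpp)
  · gcongr
  · exact div_nonneg (by linarith) hq1'.le
  · exact (div_le_one hq1').2 (by linarith)
  · exact div_nonneg (by linarith) hq1'.le
  · exact (div_le_one hq1').2 (by linarith)
  · gcongr

lemma bernoulliDiv_eq {p q : ℝ} (hq0 : 0 < q) (hq1 : q < 1) :
    bernoulliDiv p q =
      -Real.negMulLog p - p * Real.log q - Real.negMulLog (1 - p) - (1 - p) * Real.log (1 - q) := by
  have hq1' : 0 < 1 - q := by linarith
  have key (a b : ℝ) (hb : 0 < b) :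
      b * klFun (a / b) = -Real.negMulLog a - a * Real.log b + b - a := by
    rcases eq_or_ne a 0 with rfl | ha
    · simp [klFun_zero]
    · rw [klFun_apply, Real.log_div ha hb.ne', Real.negMulLog]
      field_simp
  rw [bernoulliDiv, key _ _ hq0, key _ _ hq1']
  ring

/-- The relative entropy achieved by a radial quantizer of false-alarm probability `q`, whose
detection probability is `q ^ r`. -/
noncomputable def radialDiv (r q : ℝ) : ℝ := bernoulliDiv (q ^ r) q

lemma radialDiv_zero {r : ℝ} (hr : 0 < r) : radialDiv r 0 = 0 := by
  simp [radialDiv, bernoulliDiv, Real.zero_rpow hr.ne', klFun_one]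

lemma radialDiv_one (r : ℝ) : radialDiv r 1 = 0 := by
  simp [radialDiv, bernoulliDiv, klFun_one]

lemma radialDiv_eq {r q : ℝ} (hr : 0 < r) (hq : q ∈ Set.Icc (0 : ℝ) 1) :
    radialDiv r q = (1 / r - 1) * Real.negMulLog (q ^ r) - Real.negMulLog (1 - q ^ r)
      - (1 - q ^ r) * Real.log (1 - q) := by
  rcases hq.1.eq_or_lt with rfl | hq0
  · simp [radialDiv_zero hr, Real.zero_rpow hr.ne']
  rcases hq.2.eq_or_lt with rfl | hq1
  · simp [radialDiv_one]
  rw [radialDiv, bernoulliDiv_eq hq0 hq1]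
  have : q ^ r * Real.log q = -(1 / r) * Real.negMulLog (q ^ r) := by
    rw [Real.negMulLog, Real.log_rpow hq0]
    field_simp
  rw [this]
  ring

lemma le_rpow_of_le_one {r q : ℝ} (hr1 : r ≤ 1) (hq : q ∈ Set.Ioc (0 : ℝ) 1) : q ≤ q ^ r := by
  simpa using Real.rpow_le_rpow_of_exponent_ge hq.1 hq.2 hr1

lemma continuousOn_radialDiv {r : ℝ} (hr : 0 < r) (hr1 : r ≤ 1) :
    ContinuousOn (radialDiv r) (Set.Icc 0 1) := by
  have hpow : Continuous fun q : ℝ => q ^ r := Real.continuous_rpow_const hr.le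
  refine ContinuousOn.congr (f := fun q : ℝ => (1 / r - 1) * Real.negMulLog (q ^ r)
    - Real.negMulLog (1 - q ^ r) - (1 - q ^ r) * Real.log (1 - q)) ?_
    fun q hq => radialDiv_eq hr hq
  refine ContinuousOn.sub (Continuous.continuousOn ?_) fun q hq => ?_
  · exact ((Real.continuous_negMulLog.comp hpow).const_mul _).sub
      (Real.continuous_negMulLog.comp (continuous_const.sub hpow))
  · rcases eq_or_ne q 1 with rfl | hq1
    · -- Near `q = 1` the last term is dominated by `(1 - q) * log (1 - q)`, since `q ≤ q ^ r`.
      have hlim : Filter.Tendsto (fun q : ℝ => Real.negMulLog (1 - q))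
          (nhdsWithin 1 (Set.Icc 0 1)) (nhds 0) := by
        have : Continuous fun q : ℝ => Real.negMulLog (1 - q) :=
          Real.continuous_negMulLog.comp (continuous_const.sub continuous_id)
        simpa using (this.tendsto 1).mono_left nhdsWithin_le_nhds
      rw [ContinuousWithinAt]
      simp only [Real.one_rpow, sub_self, zero_mul]
      refine squeeze_zero_norm' ?_ hlim
      have h0 : ∀ᶠ q : ℝ in nhdsWithin 1 (Set.Icc 0 1), 0 < q :=
        nhdsWithin_le_nhds (lt_mem_nhds one_pos)
      filter_upwards [self_mem_nhdsWithin, h0] with q hq hq0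
      have h1 := le_rpow_of_le_one hr1 ⟨hq0, hq.2⟩
      have h2 : q ^ r ≤ 1 := Real.rpow_le_one hq.1 hq.2 hr.le
      have h3 : Real.log (1 - q) ≤ 0 := Real.log_nonpos (by linarith [hq.2]) (by linarith)
      rw [Real.norm_eq_abs, abs_mul, abs_of_nonneg (by linarith), abs_of_nonpos h3,
        Real.negMulLog, neg_mul, ← mul_neg]
      exact mul_le_mul_of_nonneg_right (by linarith) (by linarith)
    · have hne : 1 - q ≠ 0 := sub_ne_zero.2 hq1.symm
      exact ((continuous_const.sub hpow).continuousAt.mul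
        ((continuous_const.sub continuous_id).continuousAt.log hne)).continuousWithinAt

lemma negMulLog_le_exp_neg_one {p : ℝ} (hp : 0 ≤ p) : Real.negMulLog p ≤ Real.exp (-1) := by
  rcases hp.eq_or_lt with rfl | hp
  · simp [(Real.exp_pos _).le]
  have h := Real.log_le_sub_one_of_pos (div_pos (Real.exp_pos (-1)) hp)
  rw [Real.log_div (Real.exp_pos _).ne' hp.ne', Real.log_exp] at h
  have h2 := mul_le_mul_of_nonneg_left (show -Real.log p ≤ Real.exp (-1) / p by linarith) hp.le
  rw [mul_div_cancel₀ _ hp.ne'] at h2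
  rw [Real.negMulLog]
  linarith

lemma radialDiv_le {r q : ℝ} (hr : 0 < r) (hr1 : r ≤ 1) (hq : q ∈ Set.Icc (0 : ℝ) 1) :
    radialDiv r q ≤ (1 / r - 1) * Real.exp (-1) := by
  have hr' : 0 ≤ 1 / r - 1 := sub_nonneg.2 (by rw [le_div_iff₀ hr]; linarith)
  have hpow0 : 0 ≤ q ^ r := Real.rpow_nonneg hq.1 r
  rcases hq.1.eq_or_lt with rfl | hq0
  · rw [radialDiv_zero hr]; positivity
  rcases hq.2.eq_or_lt with rfl | hq1
  · rw [radialDiv_one]; positivity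
  have h1 : q ≤ q ^ r := le_rpow_of_le_one hr1 ⟨hq0, hq1.le⟩
  have h2 : q ^ r < 1 := Real.rpow_lt_one hq0.le hq1 hr
  -- The miss probabilities contribute `(1 - p) * log ((1 - p) / (1 - q)) ≤ 0`.
  have h3 : (1 - q ^ r) * Real.log (1 - q ^ r) ≤ (1 - q ^ r) * Real.log (1 - q) :=
    mul_le_mul_of_nonneg_left (Real.log_le_log (by linarith) (by linarith)) (by linarith)
  have h4 := mul_le_mul_of_nonneg_left (negMulLog_le_exp_neg_one hpow0) hr'
  rw [radialDiv_eq hr hq]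
  simp only [Real.negMulLog] at h4 ⊢
  linarith

/-! ### Radial regions are most powerful -/

lemma integrable_complexGaussianPDF {v : ℝ≥0} (hv : v ≠ 0) :
    Integrable (complexGaussianPDF v) := by
  refine ⟨(measurable_complexGaussianPDF v).aestronglyMeasurable, ?_⟩
  rw [hasFiniteIntegral_iff_ofReal
    (Filter.Eventually.of_forall fun z => (complexGaussianPDF_pos hv z).le)]
  have : complexGaussian v Set.univ < ∞ := measure_lt_top _ _
  rwa [complexGaussian_eq_withDensity hv, withDensity_apply _ MeasurableSet.univ,
    Measure.restrict_univ] at this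

lemma complexGaussian_real_eq_setIntegral {v : ℝ≥0} (hv : v ≠ 0) {S : Set ℂ}
    (hS : MeasurableSet S) :
    (complexGaussian v).real S = ∫ z in S, complexGaussianPDF v z := by
  rw [measureReal_def, complexGaussian_eq_withDensity hv, withDensity_apply _ hS,
    integral_eq_lintegral_of_nonneg_ae
      (Filter.Eventually.of_forall fun z => (complexGaussianPDF_pos hv z).le)
      (measurable_complexGaussianPDF v).aestronglyMeasurable]

lemma complexGaussian_absolutelyContinuous {v w : ℝ≥0} (hv : v ≠ 0) (hw : w ≠ 0) :
    complexGaussian v ≪ complexGaussian w :=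
  (complexGaussian_absolutelyContinuous_volume hv).trans
    (volume_absolutelyContinuous_complexGaussian hw)

/-- The threshold at which the radial region has probability `q` under `complexGaussian v`. -/
noncomputable def radialThreshold (v : ℝ≥0) (q : ℝ) : ℝ := √(v * -Real.log q)

lemma radialThreshold_pos {v : ℝ≥0} (hv : v ≠ 0) {q : ℝ} (hq : q ∈ Set.Ioo (0 : ℝ) 1) :
    0 < radialThreshold v q := by
  have hv' : (0 : ℝ) < v := by positivity
  exact Real.sqrt_pos.2 (mul_pos hv' (neg_pos.2 (Real.log_neg hq.1 hq.2)))

lemma complexGaussian_real_radialThreshold {v w : ℝ≥0} (hw : w ≠ 0) {q : ℝ}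
    (hq : q ∈ Set.Ioo (0 : ℝ) 1) :
    (complexGaussian w).real (radialRegion (radialThreshold v q)) = q ^ (v / w : ℝ) := by
  have h : 0 ≤ v * -Real.log q :=
    mul_nonneg v.2 (neg_nonneg.2 (Real.log_neg hq.1 hq.2).le)
  rw [measureReal_def, radialThreshold,
    complexGaussian_radialRegion hw (Real.sqrt_nonneg _),
    ENNReal.toReal_ofReal (Real.exp_pos _).le, Real.rpow_def_of_pos hq.1, Real.sq_sqrt h]
  congr 1
  ring

/-- Neyman-Pearson: among all Borel sets of a given probability under the narrower Gaussian law,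
the radial region has the largest probability under the wider one, because the likelihood ratio
increases with the modulus. -/
lemma complexGaussian_real_le_rpow {v w : ℝ≥0} (hv : v ≠ 0) (hvw : v ≤ w) {D : Set ℂ}
    (hD : MeasurableSet D) :
    (complexGaussian w).real D ≤ (complexGaussian v).real D ^ (v / w : ℝ) := by
  have hw : w ≠ 0 := (lt_of_lt_of_le (by positivity) hvw).ne'
  have hv' : (0 : ℝ) < v := by positivity
  have hw' : (0 : ℝ) < w := by positivity
  rcases hvw.eq_or_lt with rfl | hlt
  · rw [div_self hv'.ne', Real.rpow_one]
  set q := (complexGaussian v).real D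
  have hq1 : q ≤ 1 := measureReal_le_one
  rcases (measureReal_nonneg : 0 ≤ q).eq_or_lt with h0 | h0
  · have : (complexGaussian w).real D = 0 := by
      rw [measureReal_eq_zero_iff]
      exact complexGaussian_absolutelyContinuous hw hv ((measureReal_eq_zero_iff).1 h0.symm)
    rw [this]; positivity
  rcases hq1.eq_or_lt with h1 | h1
  · rw [h1, Real.one_rpow]; exact measureReal_le_one
  have hqI : q ∈ Set.Ioo (0 : ℝ) 1 := ⟨h0, h1⟩
  set T := radialThreshold v q
  have hT : 0 < T := radialThreshold_pos hv hqI
  have hvw' : (v : ℝ) < w := hlt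
  have hgap : 0 < 1 / (v : ℝ) - 1 / w := sub_pos.2 (one_div_lt_one_div_of_lt hv' hvw')
  -- The value of the likelihood ratio on the circle of radius `T`.
  set k : ℝ := v / w * Real.exp (T ^ 2 * (1 / (v : ℝ) - 1 / w)) with hk
  have hset : {z | 0 ≤ complexGaussianPDF w z - k * complexGaussianPDF v z} = radialRegion T := by
    ext z
    have : complexGaussianPDF w z - k * complexGaussianPDF v z = (Real.pi * w)⁻¹ *
        (Real.exp (-‖z‖ ^ 2 / w) -
          Real.exp (T ^ 2 * (1 / (v : ℝ) - 1 / w) + -‖z‖ ^ 2 / v)) := by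
      rw [complexGaussianPDF, complexGaussianPDF, hk, Real.exp_add]
      field_simp
    rw [Set.mem_ofPred_eq, this, mul_nonneg_iff_of_pos_left (by positivity), sub_nonneg,
      Real.exp_le_exp, radialRegion, Set.mem_ofPred_eq,
      ← pow_le_pow_iff_left₀ hT.le (norm_nonneg z) two_ne_zero,
      ← mul_le_mul_iff_left₀ (b := T ^ 2) hgap]
    have e : ‖z‖ ^ 2 * (1 / (v : ℝ) - 1 / w) = -‖z‖ ^ 2 / w - -‖z‖ ^ 2 / v := by ring
    rw [e]
    constructor <;> intro h <;> linarith
  have hiv := integrable_complexGaussianPDF hv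
  have hiw := integrable_complexGaussianPDF hw
  have hmain := setIntegral_le_nonneg (μ := (volume : Measure ℂ)) hD
    (f := fun z => complexGaussianPDF w z - k * complexGaussianPDF v z)
    (((measurable_complexGaussianPDF w).sub
      ((measurable_complexGaussianPDF v).const_mul k)).stronglyMeasurable)
    (hiw.sub (hiv.const_mul k))
  have hsplit (S : Set ℂ) (hS : MeasurableSet S) :
      ∫ z in S, (complexGaussianPDF w z - k * complexGaussianPDF v z) =
        (complexGaussian w).real S - k * (complexGaussian v).real S := by
    rw [integral_sub hiw.integrableOn (hiv.const_mul k).integrableOn, integral_const_mul,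
      complexGaussian_real_eq_setIntegral hv hS, complexGaussian_real_eq_setIntegral hw hS]
  rw [hset, hsplit _ hD, hsplit _ (measurableSet_radialRegion T),
    complexGaussian_real_radialThreshold hw hqI, complexGaussian_real_radialThreshold hv hqI,
    div_self hv'.ne', Real.rpow_one] at hmain
  linarith

/-! ### The noncoherent channel -/

lemma noncoherentOutputLaw_eq (σ : ℝ≥0) {D : Set ℂ} (hD : MeasurableSet D) (x : ℂ) :
    noncoherentOutputLaw σ D x = (complexGaussian (‖x‖₊ ^ 2 + σ ^ 2)).map (quantize D) := by
  have h := map_mul_add_complexGaussian 1 (σ ^ 2) x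
  rw [one_mul] at h
  rw [← h, Measure.map_map (measurable_quantize hD) (by fun_prop)]
  rfl

lemma map_quantize_real_true {D : Set ℂ} (hD : MeasurableSet D) (μ : Measure ℂ) :
    (μ.map (quantize D)).real {true} = μ.real D := by
  rw [map_measureReal_apply (measurable_quantize hD) (measurableSet_singleton _),
    quantize_preimage_true]

lemma noncoherentOutputLaw_absolutelyContinuous {σ : ℝ≥0} (hσ : 0 < σ) {D : Set ℂ}
    (hD : MeasurableSet D) (x y : ℂ) :
    noncoherentOutputLaw σ D x ≪ noncoherentOutputLaw σ D y := by
  rw [noncoherentOutputLaw_eq σ hD, noncoherentOutputLaw_eq σ hD]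
  exact (complexGaussian_absolutelyContinuous (by positivity) (by positivity)).map
    (measurable_quantize hD)

lemma noncoherentRelEntropy_eq {σ : ℝ≥0} (hσ : 0 < σ) {D : Set ℂ} (hD : MeasurableSet D) (x : ℂ) :
    noncoherentRelEntropy σ D x = ENNReal.ofReal (bernoulliDiv
      ((complexGaussian (‖x‖₊ ^ 2 + σ ^ 2)).real D) ((complexGaussian (σ ^ 2)).real D)) := by
  have hac := noncoherentOutputLaw_absolutelyContinuous hσ hD x 0
  have e : (‖(0 : ℂ)‖₊ ^ 2 + σ ^ 2) = σ ^ 2 := by simp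
  rw [noncoherentOutputLaw_eq σ hD, noncoherentOutputLaw_eq σ hD, e] at hac
  have hp (v : ℝ≥0) : IsProbabilityMeasure ((complexGaussian v).map (quantize D)) :=
    Measure.isProbabilityMeasure_map (measurable_quantize hD).aemeasurable
  rw [noncoherentRelEntropy, noncoherentOutputLaw_eq σ hD, noncoherentOutputLaw_eq σ hD, e,
    klDiv_bool hac, map_quantize_real_true hD, map_quantize_real_true hD]

/-- The ratio of the output variances without and with input `x`. -/
noncomputable def varianceRatio (σ : ℝ≥0) (x : ℂ) : ℝ :=
  ((σ ^ 2 : ℝ≥0) : ℝ) / ((‖x‖₊ ^ 2 + σ ^ 2 : ℝ≥0) : ℝ)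

lemma varianceRatio_pos {σ : ℝ≥0} (hσ : 0 < σ) (x : ℂ) : 0 < varianceRatio σ x := by
  have : (0 : ℝ) < σ := hσ
  unfold varianceRatio; push_cast; positivity

lemma varianceRatio_le_one {σ : ℝ≥0} (x : ℂ) : varianceRatio σ x ≤ 1 := by
  refine div_le_one_of_le₀ ?_ (NNReal.coe_nonneg _)
  exact_mod_cast (le_add_self : σ ^ 2 ≤ ‖x‖₊ ^ 2 + σ ^ 2)

/-- Every quantization region is dominated by a radial one: by the radial region of the same
false-alarm probability if the input makes the region more likely, and otherwise by the radial
region with the false-alarm probability of the complement. -/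
lemma noncoherentRelEntropy_le_radialDiv {σ : ℝ≥0} (hσ : 0 < σ) {D : Set ℂ}
    (hD : MeasurableSet D) (x : ℂ) :
    ∃ q ∈ Set.Icc (0 : ℝ) 1,
      noncoherentRelEntropy σ D x ≤ ENNReal.ofReal (radialDiv (varianceRatio σ x) q) := by
  have hv : σ ^ 2 ≠ 0 := by positivity
  have hvw : σ ^ 2 ≤ ‖x‖₊ ^ 2 + σ ^ 2 := le_add_self
  have main (E : Set ℂ) (hE : MeasurableSet E)
      (hle : (complexGaussian (σ ^ 2)).real E ≤ (complexGaussian (‖x‖₊ ^ 2 + σ ^ 2)).real E) :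
      bernoulliDiv ((complexGaussian (‖x‖₊ ^ 2 + σ ^ 2)).real E)
        ((complexGaussian (σ ^ 2)).real E) ≤
        radialDiv (varianceRatio σ x) ((complexGaussian (σ ^ 2)).real E) := by
    have hnp := complexGaussian_real_le_rpow hv hvw hE
    have hrp := varianceRatio_pos hσ x
    rw [← varianceRatio] at hnp
    set p := (complexGaussian (‖x‖₊ ^ 2 + σ ^ 2)).real E
    set q := (complexGaussian (σ ^ 2)).real E
    have hp0 : 0 ≤ p := measureReal_nonneg
    have hq0 : 0 ≤ q := measureReal_nonneg
    have hp1 : p ≤ 1 := measureReal_le_one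
    have hq1 : q ≤ 1 := measureReal_le_one
    rcases hq0.eq_or_lt with h0 | h0
    · rw [← h0, Real.zero_rpow hrp.ne'] at hnp
      rw [← h0, radialDiv, Real.zero_rpow hrp.ne', le_antisymm hnp hp0]
    rcases hq1.eq_or_lt with h1 | h1
    · rw [radialDiv, h1, Real.one_rpow, le_antisymm hp1 (h1 ▸ hle)]
    exact bernoulliDiv_mono h0 h1 hle hnp (Real.rpow_le_one h0.le hq1 hrp.le)
  rw [noncoherentRelEntropy_eq hσ hD]
  rcases le_total ((complexGaussian (σ ^ 2)).real D)
    ((complexGaussian (‖x‖₊ ^ 2 + σ ^ 2)).real D) with h | h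
  · exact ⟨_, ⟨measureReal_nonneg, measureReal_le_one⟩, ENNReal.ofReal_le_ofReal (main D hD h)⟩
  · refine ⟨_, ⟨measureReal_nonneg, measureReal_le_one⟩,
      ENNReal.ofReal_le_ofReal (le_trans (le_of_eq ?_) (main Dᶜ hD.compl ?_))⟩
    · rw [probReal_compl_eq_one_sub hD, probReal_compl_eq_one_sub hD, bernoulliDiv_symm]
    · rw [probReal_compl_eq_one_sub hD, probReal_compl_eq_one_sub hD]
      linarith

lemma noncoherentRelEntropy_radialThreshold {σ : ℝ≥0} (hσ : 0 < σ) (x : ℂ) {q : ℝ}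
    (hq : q ∈ Set.Ioo (0 : ℝ) 1) :
    noncoherentRelEntropy σ (radialRegion (radialThreshold (σ ^ 2) q)) x =
      ENNReal.ofReal (radialDiv (varianceRatio σ x) q) := by
  have hv : ((σ ^ 2 : ℝ≥0) : ℝ) ≠ 0 := by positivity
  rw [noncoherentRelEntropy_eq hσ (measurableSet_radialRegion _),
    complexGaussian_real_radialThreshold (by positivity) hq,
    complexGaussian_real_radialThreshold (by positivity) hq, div_self hv, Real.rpow_one]
  rfl

lemma exists_radialRegion_optimal {σ : ℝ≥0} (hσ : 0 < σ) (x : ℂ) :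
    ∃ T : ℝ, 0 < T ∧ ∀ D : Set ℂ, MeasurableSet D →
      noncoherentRelEntropy σ D x ≤ noncoherentRelEntropy σ (radialRegion T) x := by
  have hr := varianceRatio_pos hσ x
  obtain ⟨q, hq, hmax⟩ := isCompact_Icc.exists_isMaxOn (Set.nonempty_Icc.2 zero_le_one)
    (continuousOn_radialDiv hr (varianceRatio_le_one x))
  have hbound (D : Set ℂ) (hD : MeasurableSet D) : noncoherentRelEntropy σ D x ≤
      ENNReal.ofReal (radialDiv (varianceRatio σ x) q) := by
    obtain ⟨q', hq', hle⟩ := noncoherentRelEntropy_le_radialDiv hσ hD x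
    exact hle.trans (ENNReal.ofReal_le_ofReal (hmax hq'))
  by_cases hI : q ∈ Set.Ioo (0 : ℝ) 1
  · refine ⟨_, radialThreshold_pos (by positivity : σ ^ 2 ≠ 0) hI, fun D hD => ?_⟩
    rw [noncoherentRelEntropy_radialThreshold hσ x hI]
    exact hbound D hD
  · -- If the maximum sits at an endpoint, all relative entropies vanish.
    have h0 : radialDiv (varianceRatio σ x) q = 0 := by
      rcases hq.1.eq_or_lt with rfl | h0
      · exact radialDiv_zero hr
      · rw [le_antisymm hq.2 (not_lt.1 fun h => hI ⟨h0, h⟩), radialDiv_one]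
    refine ⟨1, one_pos, fun D hD => (hbound D hD).trans ?_⟩
    simp [h0]

lemma noncoherentRelEntropy_le {σ : ℝ≥0} (hσ : 0 < σ) {D : Set ℂ} (hD : MeasurableSet D) (x : ℂ) :
    noncoherentRelEntropy σ D x ≤
      1 / (ENNReal.ofReal (Real.exp 1) * (σ : ℝ≥0∞) ^ 2) * ‖x‖ₑ ^ 2 := by
  obtain ⟨q, hq, hle⟩ := noncoherentRelEntropy_le_radialDiv hσ hD x
  have hσ' : (0 : ℝ) < σ := hσ
  refine hle.trans ((ENNReal.ofReal_le_ofReal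
    (radialDiv_le (varianceRatio_pos hσ x) (varianceRatio_le_one x) hq)).trans_eq ?_)
  have e : (1 / varianceRatio σ x - 1) * Real.exp (-1) =
      1 / (Real.exp 1 * (σ : ℝ) ^ 2) * ‖x‖ ^ 2 := by
    rw [varianceRatio, Real.exp_neg]
    push_cast
    field_simp
    ring
  rw [e, ENNReal.ofReal_mul (by positivity), ENNReal.ofReal_div_of_pos (by positivity),
    ENNReal.ofReal_mul (Real.exp_pos _).le, ENNReal.ofReal_pow (norm_nonneg _), ofReal_norm,
    ENNReal.ofReal_pow hσ'.le, ENNReal.ofReal_coe_nnreal, ENNReal.ofReal_one]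

lemma measurable_noncoherent {D : Set ℂ} (hD : MeasurableSet D) :
    Measurable fun ω : ℂ × ℂ × ℂ => quantize D (ω.2.1 * ω.1 + ω.2.2) :=
  (measurable_quantize hD).comp (by fun_prop)

lemma noncoherentCapacityPerUnitEnergy_le {σ : ℝ≥0} (hσ : 0 < σ) :
    noncoherentCapacityPerUnitEnergy σ ≤
      1 / (ENNReal.ofReal (Real.exp 1) * (σ : ℝ≥0∞) ^ 2) := by
  refine iSup₂_le fun P hP => ENNReal.div_le_of_le_mul ?_
  refine iSup₂_le fun μ hμ => iSup₂_le fun D hD => ?_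
  have := hμ.1
  have hprob : IsProbabilityMeasure (noncoherentOutputLaw σ D 0) := by
    rw [noncoherentOutputLaw_eq σ hD]
    exact Measure.isProbabilityMeasure_map (measurable_quantize hD).aemeasurable
  calc noncoherentInfo σ μ D
      ≤ ∫⁻ x, noncoherentRelEntropy σ D x ∂μ :=
        mutualInfo_channel_le (measurable_noncoherent hD) (Q := noncoherentOutputLaw σ D 0)
          fun x => noncoherentOutputLaw_absolutelyContinuous hσ hD x 0
    _ ≤ ∫⁻ x, 1 / (ENNReal.ofReal (Real.exp 1) * (σ : ℝ≥0∞) ^ 2) * ‖x‖ₑ ^ 2 ∂μ :=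
        lintegral_mono fun x => noncoherentRelEntropy_le hσ hD x
    _ = 1 / (ENNReal.ofReal (Real.exp 1) * (σ : ℝ≥0∞) ^ 2) * ∫⁻ x, ‖x‖ₑ ^ 2 ∂μ :=
        lintegral_const_mul _ (by fun_prop)
    _ ≤ _ := by gcongr; exact hμ.2

lemma noncoherentCapacityPerUnitEnergy_lt {σ : ℝ≥0} (hσ : 0 < σ) :
    noncoherentCapacityPerUnitEnergy σ < 1 / (σ : ℝ≥0∞) ^ 2 := by
  have hσ' : (0 : ℝ) < σ := hσ
  refine (noncoherentCapacityPerUnitEnergy_le hσ).trans_lt ?_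
  have h1 : (1 : ℝ) < Real.exp 1 := Real.one_lt_exp_iff.2 one_pos
  have e1 : ENNReal.ofReal (Real.exp 1) * (σ : ℝ≥0∞) ^ 2 =
      ENNReal.ofReal (Real.exp 1 * (σ : ℝ) ^ 2) := by
    rw [ENNReal.ofReal_mul (Real.exp_pos _).le, ENNReal.ofReal_pow hσ'.le,
      ENNReal.ofReal_coe_nnreal]
  have e2 : (σ : ℝ≥0∞) ^ 2 = ENNReal.ofReal ((σ : ℝ) ^ 2) := by
    rw [ENNReal.ofReal_pow hσ'.le, ENNReal.ofReal_coe_nnreal]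
  rw [e1, e2, one_div, one_div, ENNReal.inv_lt_inv, ENNReal.ofReal_lt_ofReal_iff (by positivity)]
  exact lt_mul_of_one_lt_left (by positivity) h1

/-! ### The coherent channel: upper bound -/

lemma measurableSet_section {D : ℂ → Set ℂ} (hD : D ∈ coherentRules) (h : ℂ) :
    MeasurableSet (D h) :=
  measurable_prodMk_left (x := h) hD

lemma measurable_quantize_coherent {D : Set ℂ} (hD : MeasurableSet D) (h x : ℂ) :
    Measurable fun z => quantize D (h * x + z) :=
  (measurable_quantize hD).comp (measurable_const_add _)

lemma coherentOutputLaw_eq_map (σ : ℝ≥0) {D : Set ℂ} (hD : MeasurableSet D) (h x : ℂ) :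
    coherentOutputLaw σ D h x = ((noiseLaw σ).map (h * x + ·)).map (quantize D) := by
  rw [Measure.map_map (measurable_quantize hD) (measurable_const_add _)]
  rfl

lemma isProbabilityMeasure_coherentOutputLaw (σ : ℝ≥0) {D : Set ℂ} (hD : MeasurableSet D)
    (h x : ℂ) : IsProbabilityMeasure (coherentOutputLaw σ D h x) :=
  Measure.isProbabilityMeasure_map (measurable_quantize_coherent hD h x).aemeasurable

lemma coherentOutputLaw_absolutelyContinuous {σ : ℝ≥0} (hσ : 0 < σ) {D : Set ℂ}
    (hD : MeasurableSet D) (h x y : ℂ) :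
    coherentOutputLaw σ D h x ≪ coherentOutputLaw σ D h y := by
  have hv : σ ^ 2 ≠ 0 := by positivity
  have hvol (m : ℂ) : (volume : Measure ℂ).map (m + ·) = volume :=
    (measurePreserving_add_left volume m).map_eq
  have h1 : (noiseLaw σ).map (h * x + ·) ≪ volume := by
    have := (complexGaussian_absolutelyContinuous_volume hv).map (measurable_const_add (h * x))
    rwa [hvol] at this
  have h2 : volume ≪ (noiseLaw σ).map (h * y + ·) := by
    have := (volume_absolutelyContinuous_complexGaussian hv).map (measurable_const_add (h * y))
    rwa [hvol] at this
  rw [coherentOutputLaw_eq_map σ hD, coherentOutputLaw_eq_map σ hD]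
  exact (h1.trans h2).map (measurable_quantize hD)

/-- Data processing: quantization cannot increase the relative entropy between the shifted and the
centered noise law. -/
lemma klDiv_coherentOutputLaw_le {σ : ℝ≥0} (hσ : 0 < σ) {D : Set ℂ} (hD : MeasurableSet D)
    (h x : ℂ) : klDiv (coherentOutputLaw σ D h x) (coherentOutputLaw σ D h 0) ≤
      1 / (σ : ℝ≥0∞) ^ 2 * ‖x‖ₑ ^ 2 * ‖h‖ₑ ^ 2 := by
  have hv : σ ^ 2 ≠ 0 := by positivity
  have hσ' : (0 : ℝ) < σ := hσ
  have h0 : (noiseLaw σ).map (h * 0 + ·) = noiseLaw σ := by simp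
  have := Measure.isProbabilityMeasure_map (μ := noiseLaw σ)
    (measurable_const_add (h * x)).aemeasurable
  rw [coherentOutputLaw_eq_map σ hD, coherentOutputLaw_eq_map σ hD, h0]
  refine (klDiv_map_le _ _ (measurable_quantize hD)).trans_eq ?_
  rw [noiseLaw, klDiv_map_add_complexGaussian hv]
  have e : ‖h * x‖ ^ 2 / ((σ ^ 2 : ℝ≥0) : ℝ) = 1 / (σ : ℝ) ^ 2 * ‖x‖ ^ 2 * ‖h‖ ^ 2 := by
    rw [norm_mul]; push_cast; ring
  rw [e, ENNReal.ofReal_mul (by positivity), ENNReal.ofReal_mul (by positivity),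
    ENNReal.ofReal_div_of_pos (by positivity), ENNReal.ofReal_pow (norm_nonneg _), ofReal_norm,
    ENNReal.ofReal_pow (norm_nonneg _), ofReal_norm, ENNReal.ofReal_pow hσ'.le,
    ENNReal.ofReal_coe_nnreal, ENNReal.ofReal_one]

lemma lintegral_norm_sq_fadingLaw : ∫⁻ h, ‖h‖ₑ ^ 2 ∂fadingLaw = 1 :=
  lintegral_norm_sq_complexGaussian 1

lemma coherentRelEntropy_le {σ : ℝ≥0} (hσ : 0 < σ) {D : ℂ → Set ℂ} (hD : D ∈ coherentRules)
    (x : ℂ) : coherentRelEntropy σ D x ≤ 1 / (σ : ℝ≥0∞) ^ 2 * ‖x‖ₑ ^ 2 := by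
  refine (lintegral_mono fun h =>
    klDiv_coherentOutputLaw_le hσ (measurableSet_section hD h) h x).trans_eq ?_
  rw [lintegral_const_mul _ (by fun_prop), lintegral_norm_sq_fadingLaw, mul_one]

lemma measurable_coherent {D : Set ℂ} (hD : MeasurableSet D) (h : ℂ) :
    Measurable fun ω : ℂ × ℂ => quantize D (h * ω.1 + ω.2) :=
  (measurable_quantize hD).comp (by fun_prop)

lemma coherentInfo_le {σ : ℝ≥0} (hσ : 0 < σ) {P : ℝ≥0} {μ : Measure ℂ} (hμ : μ ∈ inputLaws P)
    {D : ℂ → Set ℂ} (hD : D ∈ coherentRules) :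
    coherentInfo σ μ D ≤ 1 / (σ : ℝ≥0∞) ^ 2 * P := by
  have := hμ.1
  have hh (h : ℂ) : mutualInfo (μ.prod (noiseLaw σ)) (fun ω : ℂ × ℂ => ω.1)
      (fun ω : ℂ × ℂ => quantize (D h) (h * ω.1 + ω.2)) ≤
      1 / (σ : ℝ≥0∞) ^ 2 * P * ‖h‖ₑ ^ 2 := by
    have hDh := measurableSet_section hD h
    have := isProbabilityMeasure_coherentOutputLaw σ hDh h 0
    calc _ ≤ ∫⁻ x, klDiv (coherentOutputLaw σ (D h) h x) (coherentOutputLaw σ (D h) h 0) ∂μ :=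
          mutualInfo_channel_le (measurable_coherent hDh h)
            (Q := coherentOutputLaw σ (D h) h 0)
            fun x => coherentOutputLaw_absolutelyContinuous hσ hDh h x 0
      _ ≤ ∫⁻ x, 1 / (σ : ℝ≥0∞) ^ 2 * ‖x‖ₑ ^ 2 * ‖h‖ₑ ^ 2 ∂μ :=
          lintegral_mono fun x => klDiv_coherentOutputLaw_le hσ hDh h x
      _ = 1 / (σ : ℝ≥0∞) ^ 2 * (∫⁻ x, ‖x‖ₑ ^ 2 ∂μ) * ‖h‖ₑ ^ 2 := by
          rw [lintegral_mul_const _ (by fun_prop), lintegral_const_mul _ (by fun_prop)]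
      _ ≤ _ := by gcongr; exact hμ.2
  refine (lintegral_mono hh).trans_eq ?_
  rw [lintegral_const_mul _ (by fun_prop), lintegral_norm_sq_fadingLaw, mul_one]

lemma coherentCapacityPerUnitEnergy_le {σ : ℝ≥0} (hσ : 0 < σ) :
    coherentCapacityPerUnitEnergy σ coherentRules ≤ 1 / (σ : ℝ≥0∞) ^ 2 :=
  iSup₂_le fun _ _ => ENNReal.div_le_of_le_mul <|
    iSup₂_le fun _ hμ => iSup₂_le fun _ hD => coherentInfo_le hσ hμ hD

lemma radialRules_subset_coherentRules : radialRules ⊆ coherentRules := by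
  rintro D ⟨T, hT, -, hD⟩
  have : {p : ℂ × ℂ | p.2 ∈ D p.1} = {p : ℂ × ℂ | T p.1 ≤ ‖p.2‖} := by
    ext p; simp [hD, radialRegion]
  rw [coherentRules, Set.mem_ofPred_eq, this]
  exact measurableSet_le (hT.comp measurable_fst) measurable_snd.norm

lemma coherentCapacityPerUnitEnergy_mono (σ : ℝ≥0) {𝒟 𝒟' : Set (ℂ → Set ℂ)} (h : 𝒟 ⊆ 𝒟') :
    coherentCapacityPerUnitEnergy σ 𝒟 ≤ coherentCapacityPerUnitEnergy σ 𝒟' :=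
  iSup₂_mono fun _ _ => ENNReal.div_le_div_right
    (iSup₂_mono fun _ _ => biSup_mono fun _ hD => h hD) _

/-! ### The coherent channel: on-off signaling -/

/-- On-off signaling: the symbol `ξ` is sent with probability `δ`, and `0` otherwise. -/
noncomputable def onOffLaw (δ : ℝ) (ξ : ℂ) : Measure ℂ :=
  ENNReal.ofReal (1 - δ) • Measure.dirac 0 + ENNReal.ofReal δ • Measure.dirac ξ

lemma isProbabilityMeasure_onOffLaw {δ : ℝ} (hδ : δ ∈ Set.Icc (0 : ℝ) 1) (ξ : ℂ) :
    IsProbabilityMeasure (onOffLaw δ ξ) := by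
  constructor
  simp only [onOffLaw, Measure.coe_add, Measure.coe_smul, Pi.add_apply, Pi.smul_apply,
    measure_univ, smul_eq_mul, mul_one]
  rw [← ENNReal.ofReal_add (by linarith [hδ.2]) hδ.1]
  simp

lemma lintegral_onOffLaw (δ : ℝ) (ξ : ℂ) (f : ℂ → ℝ≥0∞) :
    ∫⁻ x, f x ∂onOffLaw δ ξ = ENNReal.ofReal (1 - δ) * f 0 + ENNReal.ofReal δ * f ξ := by
  simp [onOffLaw]

lemma coherentOutputLaw_real_true (σ : ℝ≥0) {D : Set ℂ} (hD : MeasurableSet D) (h x : ℂ) :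
    (coherentOutputLaw σ D h x).real {true} = (noiseLaw σ).real {z | h * x + z ∈ D} := by
  rw [coherentOutputLaw, map_measureReal_apply (measurable_quantize_coherent hD h x)
    (measurableSet_singleton _)]
  congr 1
  ext z; simp [quantize]

lemma map_onOffLaw_real_true (σ : ℝ≥0) {D : Set ℂ} (hD : MeasurableSet D) {δ : ℝ}
    (hδ : δ ∈ Set.Icc (0 : ℝ) 1) (h ξ : ℂ) :
    (((onOffLaw δ ξ).prod (noiseLaw σ)).map
      (fun ω : ℂ × ℂ => quantize D (h * ω.1 + ω.2))).real {true} =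
      (1 - δ) * (noiseLaw σ).real {z | h * 0 + z ∈ D} +
        δ * (noiseLaw σ).real {z | h * ξ + z ∈ D} := by
  have hp := isProbabilityMeasure_onOffLaw hδ ξ
  have hm := measurable_coherent hD h
  have e (x : ℂ) : Prod.mk x ⁻¹' ((fun ω : ℂ × ℂ => quantize D (h * ω.1 + ω.2)) ⁻¹' {true}) =
      {z | h * x + z ∈ D} := by
    ext z; simp [quantize]
  rw [measureReal_def, Measure.map_apply hm (measurableSet_singleton _),
    Measure.prod_apply (hm (measurableSet_singleton _)), lintegral_onOffLaw, e, e,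
    ENNReal.toReal_add (by finiteness) (by finiteness), ENNReal.toReal_mul, ENNReal.toReal_mul,
    ENNReal.toReal_ofReal hδ.1, ENNReal.toReal_ofReal (by linarith [hδ.2])]
  rfl

lemma measurable_noiseLaw_real_section (σ : ℝ≥0) {D : ℂ → Set ℂ} (hD : D ∈ coherentRules) (x : ℂ) :
    Measurable fun h => (noiseLaw σ).real {z | h * x + z ∈ D h} := by
  have hm : Measurable fun p : ℂ × ℂ => (p.1, p.1 * x + p.2) := by fun_prop
  exact (measurable_measure_prodMk_left (ν := noiseLaw σ) (hm hD)).ennreal_toReal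

lemma klDiv_coherentOutputLaw {σ : ℝ≥0} (hσ : 0 < σ) {D : Set ℂ} (hD : MeasurableSet D)
    (h x : ℂ) : klDiv (coherentOutputLaw σ D h x) (coherentOutputLaw σ D h 0) =
      ENNReal.ofReal (bernoulliDiv ((noiseLaw σ).real {z | h * x + z ∈ D})
        ((noiseLaw σ).real {z | h * 0 + z ∈ D})) := by
  have := isProbabilityMeasure_coherentOutputLaw σ hD h 0
  have := isProbabilityMeasure_coherentOutputLaw σ hD h x
  rw [klDiv_bool (coherentOutputLaw_absolutelyContinuous hσ hD h x 0),
    coherentOutputLaw_real_true σ hD, coherentOutputLaw_real_true σ hD]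

/-- The information of on-off signaling is at least the contribution of the symbol `ξ`: the
probability of sending it times the relative entropy between its output law and the average one. -/
lemma onOff_le_coherentInfo {σ : ℝ≥0} (hσ : 0 < σ) {D : ℂ → Set ℂ} (hD : D ∈ coherentRules)
    {δ : ℝ} (hδ : δ ∈ Set.Icc (0 : ℝ) 1) (ξ : ℂ) :
    ENNReal.ofReal δ * ∫⁻ h, ENNReal.ofReal (bernoulliDiv
      ((noiseLaw σ).real {z | h * ξ + z ∈ D h})
      ((1 - δ) * (noiseLaw σ).real {z | h * 0 + z ∈ D h} +
        δ * (noiseLaw σ).real {z | h * ξ + z ∈ D h})) ∂fadingLaw ≤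
      coherentInfo σ (onOffLaw δ ξ) D := by
  have hp := isProbabilityMeasure_onOffLaw hδ ξ
  rw [← lintegral_const_mul' _ _ ENNReal.ofReal_ne_top]
  refine lintegral_mono fun h => ?_
  have hDh := measurableSet_section hD h
  have hm := measurable_coherent hDh h
  have hac := coherentOutputLaw_absolutelyContinuous hσ hDh h
  have hacO : coherentOutputLaw σ (D h) h ξ ≪ ((onOffLaw δ ξ).prod (noiseLaw σ)).map
      (fun ω : ℂ × ℂ => quantize (D h) (h * ω.1 + ω.2)) :=
    channel_absolutelyContinuous_output (NeZero.ne _) hm hac ξ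
  have h1 := isProbabilityMeasure_coherentOutputLaw σ hDh h ξ
  have h2 := Measure.isProbabilityMeasure_map (μ := (onOffLaw δ ξ).prod (noiseLaw σ))
    hm.aemeasurable
  rw [mutualInfo_channel hm hac, lintegral_onOffLaw, ← map_onOffLaw_real_true σ hDh hδ,
    ← coherentOutputLaw_real_true σ hDh, ← klDiv_bool hacO]
  exact le_add_self

lemma continuousAt_bernoulliDiv (p : ℝ) {q : ℝ} (hq : q ∈ Set.Ioo (0 : ℝ) 1) :
    ContinuousAt (bernoulliDiv p) q := by
  have h0 : q ≠ 0 := hq.1.ne'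
  have h1 : 1 - q ≠ 0 := (sub_pos.2 hq.2).ne'
  have hk (x : ℝ) : ContinuousAt klFun x := continuous_klFun.continuousAt
  have hs : ContinuousAt (fun q : ℝ => 1 - q) q := by fun_prop
  exact (continuousAt_id.mul ((hk _).comp (continuousAt_const.div continuousAt_id h0))).add
    (hs.mul (ContinuousAt.comp (f := fun q : ℝ => (1 - p) / (1 - q)) (hk _)
      (continuousAt_const.div hs h1)))

lemma noiseLaw_real_radialRegion {σ : ℝ≥0} (hσ : 0 < σ) {T : ℝ} (hT : 0 ≤ T) :
    (noiseLaw σ).real (radialRegion T) = Real.exp (-T ^ 2 / (σ : ℝ) ^ 2) := by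
  rw [measureReal_def, noiseLaw, complexGaussian_radialRegion (by positivity) hT,
    ENNReal.toReal_ofReal (Real.exp_pos _).le]
  simp

lemma noiseLaw_real_radialRegion_mem {σ : ℝ≥0} (hσ : 0 < σ) {T : ℝ} (hT : 0 < T) :
    (noiseLaw σ).real (radialRegion T) ∈ Set.Ioo (0 : ℝ) 1 := by
  have hσ' : (0 : ℝ) < σ := hσ
  rw [noiseLaw_real_radialRegion hσ hT.le]
  refine ⟨Real.exp_pos _, Real.exp_lt_one_iff.2 ?_⟩
  rw [neg_div, neg_lt_zero]
  positivity

/-- On-off signaling with vanishing duty cycle attains the relative entropy per unit energy of any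
radial rule. -/
lemma coherentRelEntropy_div_le {σ : ℝ≥0} (hσ : 0 < σ) {D : ℂ → Set ℂ} (hD : D ∈ radialRules)
    {ξ : ℂ} (hξ : ξ ≠ 0) :
    coherentRelEntropy σ D ξ / ‖ξ‖ₑ ^ 2 ≤ coherentCapacityPerUnitEnergy σ radialRules := by
  have hDc := radialRules_subset_coherentRules hD
  obtain ⟨T, -, hT0, hDT⟩ := id hD
  set p : ℂ → ℝ := fun h => (noiseLaw σ).real {z | h * ξ + z ∈ D h} with hp
  set q : ℂ → ℝ := fun h => (noiseLaw σ).real {z | h * 0 + z ∈ D h} with hq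
  have hq' (h : ℂ) : q h ∈ Set.Ioo (0 : ℝ) 1 := by
    simp only [hq, mul_zero, zero_add, hDT]
    exact noiseLaw_real_radialRegion_mem hσ (hT0 h)
  set δ : ℕ → ℝ := fun n => 1 / ((n : ℝ) + 1) with hδ
  have hδ0 (n : ℕ) : 0 < δ n := by simp only [hδ]; positivity
  have hδ1 (n : ℕ) : δ n ≤ 1 := by
    simp only [hδ]
    exact div_le_one_of_le₀ (by linarith [(Nat.cast_nonneg n : (0 : ℝ) ≤ n)]) (by positivity)
  have hδlim : Filter.Tendsto δ Filter.atTop (nhds 0) := tendsto_one_div_add_atTop_nhds_zero_nat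
  set f : ℕ → ℂ → ℝ≥0∞ := fun n h =>
    ENNReal.ofReal (bernoulliDiv (p h) ((1 - δ n) * q h + δ n * p h)) with hf
  have hpm : Measurable p := measurable_noiseLaw_real_section σ hDc ξ
  have hqm : Measurable q := measurable_noiseLaw_real_section σ hDc 0
  have hfm (n : ℕ) : Measurable (f n) :=
    (measurable_bernoulliDiv.comp
      (hpm.prodMk ((hqm.const_mul _).add (hpm.const_mul _)))).ennreal_ofReal
  have hlim (h : ℂ) : Filter.Tendsto (fun n => f n h) Filter.atTop
      (nhds (ENNReal.ofReal (bernoulliDiv (p h) (q h)))) := by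
    refine ENNReal.tendsto_ofReal ((continuousAt_bernoulliDiv (p h) (hq' h)).tendsto.comp ?_)
    have := ((hδlim.const_sub 1).mul_const (q h)).add (hδlim.mul_const (p h))
    simpa using this
  have hbound (n : ℕ) :
      (∫⁻ h, f n h ∂fadingLaw) / ‖ξ‖ₑ ^ 2 ≤ coherentCapacityPerUnitEnergy σ radialRules := by
    have hI : δ n ∈ Set.Icc (0 : ℝ) 1 := ⟨(hδ0 n).le, hδ1 n⟩
    have hprob := isProbabilityMeasure_onOffLaw hI ξ
    set P : ℝ≥0 := (δ n).toNNReal * ‖ξ‖₊ ^ 2 with hP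
    have hP0 : 0 < P := mul_pos (Real.toNNReal_pos.2 (hδ0 n)) (pow_pos (nnnorm_pos.2 hξ) 2)
    have hPe : (P : ℝ≥0∞) = ENNReal.ofReal (δ n) * ‖ξ‖ₑ ^ 2 := by
      rw [hP]; push_cast; rfl
    have hin : onOffLaw (δ n) ξ ∈ inputLaws P := by
      refine ⟨hprob, ?_⟩
      rw [lintegral_onOffLaw, hPe]
      simp
    calc (∫⁻ h, f n h ∂fadingLaw) / ‖ξ‖ₑ ^ 2
        = (ENNReal.ofReal (δ n) * ∫⁻ h, f n h ∂fadingLaw) / P := by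
          rw [hPe, ENNReal.mul_div_mul_left _ _ (by simpa using hδ0 n) ENNReal.ofReal_ne_top]
      _ ≤ coherentInfo σ (onOffLaw (δ n) ξ) D / P :=
          ENNReal.div_le_div_right (onOff_le_coherentInfo hσ hDc hI ξ) _
      _ ≤ coherentCapacity σ radialRules P / P :=
          ENNReal.div_le_div_right ((le_iSup₂ (f := fun D (_ : D ∈ radialRules) =>
            coherentInfo σ (onOffLaw (δ n) ξ) D) D hD).trans
            (le_iSup₂ (f := fun μ (_ : μ ∈ inputLaws P) =>
              ⨆ D ∈ radialRules, coherentInfo σ μ D) _ hin)) _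
      _ ≤ coherentCapacityPerUnitEnergy σ radialRules :=
          le_iSup₂ (f := fun (P : ℝ≥0) (_ : 0 < P) => coherentCapacity σ radialRules P / P) P hP0
  have hrel : coherentRelEntropy σ D ξ =
      ∫⁻ h, Filter.liminf (fun n => f n h) Filter.atTop ∂fadingLaw := by
    refine lintegral_congr fun h => ?_
    rw [(hlim h).liminf_eq, klDiv_coherentOutputLaw hσ (measurableSet_section hDc h)]
  have hξ2 : ‖ξ‖ₑ ^ 2 ≠ 0 := by simpa using hξ
  have hξ3 : ‖ξ‖ₑ ^ 2 ≠ ∞ := by finiteness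
  rw [ENNReal.div_le_iff hξ2 hξ3, hrel]
  refine (lintegral_liminf_le hfm).trans ?_
  refine Filter.liminf_le_of_frequently_le' (Filter.Frequently.of_forall fun n => ?_)
  exact (ENNReal.div_le_iff hξ2 hξ3).1 (hbound n)

/-! ### The coherent channel: a radial rule that loses nothing at high energy -/

/-- For small `q` the relative entropy is dominated by `p * log (1 / q)`; the entropy of the
Bernoulli law, at most `log 2`, is the only loss. -/
lemma mul_neg_log_sub_log_two_le_bernoulliDiv {p q : ℝ} (hp1 : p ≤ 1) (hq0 : 0 < q) (hq1 : q < 1) :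
    p * -Real.log q - Real.log 2 ≤ bernoulliDiv p q := by
  have h1 := Real.binEntropy_le_log_two (p := p)
  rw [Real.binEntropy_eq_negMulLog_add_negMulLog_one_sub] at h1
  have h2 : (1 - p) * Real.log (1 - q) ≤ 0 :=
    mul_nonpos_of_nonneg_of_nonpos (by linarith) (Real.log_nonpos (by linarith) (by linarith))
  rw [bernoulliDiv_eq hq0 hq1]
  linarith

/-- The threshold `|h ξ| - √|h ξ|`: far below the modulus of the noiseless output compared with the
noise, yet asymptotically equal to it. The maximum with `1` only matters for small `|h ξ|`, where
it ensures positivity. -/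
noncomputable def coherentThreshold (h ξ : ℂ) : ℝ := max (‖h * ξ‖ - √‖h * ξ‖) 1

lemma coherentThreshold_pos (h ξ : ℂ) : 0 < coherentThreshold h ξ :=
  one_pos.trans_le (le_max_right _ _)

lemma measurable_coherentThreshold :
    Measurable fun p : ℂ × ℂ => coherentThreshold p.1 p.2 := by
  unfold coherentThreshold; fun_prop

lemma radialRule_coherentThreshold_mem (ξ : ℂ) :
    (fun h => radialRegion (coherentThreshold h ξ)) ∈ radialRules :=
  ⟨fun h => coherentThreshold h ξ,
    measurable_coherentThreshold.comp (measurable_id.prodMk measurable_const),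
    fun h => coherentThreshold_pos h ξ, fun _ => rfl⟩

/-- The shifted noise stays out of the disc of radius `‖m‖ - s` unless the noise exceeds `s`. -/
lemma le_noiseLaw_real_shift {σ : ℝ≥0} (hσ : 0 < σ) (m : ℂ) {s : ℝ} (hs : 0 ≤ s) :
    1 - Real.exp (-s ^ 2 / (σ : ℝ) ^ 2) ≤
      (noiseLaw σ).real {z | m + z ∈ radialRegion (‖m‖ - s)} := by
  rw [← noiseLaw_real_radialRegion hσ hs,
    ← probReal_compl_eq_one_sub (measurableSet_radialRegion s)]
  refine measureReal_mono fun z hz => ?_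
  have hz' : ‖z‖ < s := not_le.1 hz
  have h1 : ‖m‖ ≤ ‖m + z‖ + ‖z‖ := by simpa using norm_sub_le (m + z) z
  change ‖m‖ - s ≤ ‖m + z‖
  linarith

/-- A lower bound for the relative entropy of the rule `coherentThreshold` relative to the squared
modulus `a ^ 2` of the noiseless output. -/
noncomputable def coherentGain (σ : ℝ≥0) (a : ℝ) : ℝ :=
  (1 - Real.exp (-a / (σ : ℝ) ^ 2)) * ((1 - (√a)⁻¹) ^ 2 / (σ : ℝ) ^ 2) - Real.log 2 / a ^ 2

lemma tendsto_coherentGain {σ : ℝ≥0} (hσ : 0 < σ) :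
    Filter.Tendsto (coherentGain σ) Filter.atTop (nhds (1 / (σ : ℝ) ^ 2)) := by
  have hσ' : (0 : ℝ) < σ := hσ
  have h1 : Filter.Tendsto (fun a : ℝ => Real.exp (-a / (σ : ℝ) ^ 2)) Filter.atTop (nhds 0) := by
    refine Real.tendsto_exp_atBot.comp ?_
    simp_rw [neg_div]
    exact Filter.tendsto_neg_atTop_atBot.comp (Filter.tendsto_id.atTop_div_const (by positivity))
  have h2 : Filter.Tendsto (fun a : ℝ => (√a)⁻¹) Filter.atTop (nhds 0) :=
    tendsto_inv_atTop_zero.comp Real.tendsto_sqrt_atTop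
  have h3 : Filter.Tendsto (fun a : ℝ => Real.log 2 / a ^ 2) Filter.atTop (nhds 0) :=
    (Filter.tendsto_pow_atTop two_ne_zero).const_div_atTop _
  have := ((h1.const_sub 1).mul (((h2.const_sub 1).pow 2).div_const ((σ : ℝ) ^ 2))).sub h3
  rw [sub_zero, sub_zero, one_pow, one_mul] at this
  exact this

/-- The assumption `4 ≤ ‖h * ξ‖` makes the threshold equal to `‖h * ξ‖ - √‖h * ξ‖`. -/
lemma coherentGain_le_klDiv {σ : ℝ≥0} (hσ : 0 < σ) {h ξ : ℂ} (ha : 4 ≤ ‖h * ξ‖) :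
    ENNReal.ofReal (‖h * ξ‖ ^ 2 * coherentGain σ ‖h * ξ‖) ≤
      klDiv (coherentOutputLaw σ (radialRegion (coherentThreshold h ξ)) h ξ)
        (coherentOutputLaw σ (radialRegion (coherentThreshold h ξ)) h 0) := by
  have hσ' : (0 : ℝ) < σ := hσ
  set a := ‖h * ξ‖ with hadef
  have ha0 : 0 < a := by linarith
  have hs0 : 0 < √a := Real.sqrt_pos.2 ha0
  have hss : √a ^ 2 = a := Real.sq_sqrt ha0.le
  have hs2 : 2 ≤ √a := Real.le_sqrt_of_sq_le (by linarith)
  have hT : coherentThreshold h ξ = a - √a := max_eq_left (by nlinarith)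
  have hT0 : 0 < a - √a := by nlinarith
  have hD := measurableSet_radialRegion (a - √a)
  rw [hT, klDiv_coherentOutputLaw hσ hD]
  simp only [mul_zero, zero_add, Set.ofPred_mem_eq]
  refine ENNReal.ofReal_le_ofReal ?_
  have hq := noiseLaw_real_radialRegion_mem hσ hT0
  have hlog : -Real.log ((noiseLaw σ).real (radialRegion (a - √a))) =
      (a - √a) ^ 2 / (σ : ℝ) ^ 2 := by
    rw [noiseLaw_real_radialRegion hσ hT0.le, Real.log_exp]; ring
  have hp := le_noiseLaw_real_shift hσ (h * ξ) hs0.le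
  rw [← hadef, hss] at hp
  refine le_trans ?_ (mul_neg_log_sub_log_two_le_bernoulliDiv measureReal_le_one hq.1 hq.2)
  rw [hlog]
  refine le_trans (le_of_eq ?_) (sub_le_sub_right
    (mul_le_mul_of_nonneg_right hp (by positivity)) (Real.log 2))
  have e : a * (√a)⁻¹ = √a := by
    nth_rewrite 1 [← hss]
    field_simp
  have e2 : a - √a = a * (1 - (√a)⁻¹) := by rw [mul_sub, e, mul_one]
  rw [coherentGain, e2]
  field_simp

/-- The rule `coherentThreshold` attains the relative entropy per unit energy `1 / σ²` of the
unquantized channel in the limit of large input symbols. -/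
lemma le_iSup_coherentRelEntropy {σ : ℝ≥0} (hσ : 0 < σ) :
    1 / (σ : ℝ≥0∞) ^ 2 ≤ ⨆ (ξ : ℂ) (_ : ξ ≠ 0),
      coherentRelEntropy σ (fun h => radialRegion (coherentThreshold h ξ)) ξ / ‖ξ‖ₑ ^ 2 := by
  have hσ' : (0 : ℝ) < σ := hσ
  -- The symbols `n + 1` are sent. The bound `coherentGain` holds only if the noiseless output has
  -- modulus at least `4`, which for each `h ≠ 0` is eventually the case.
  set g : ℕ → ℂ → ℝ≥0∞ := fun n h =>
    {h : ℂ | 4 ≤ ‖h * ((n : ℂ) + 1)‖}.indicator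
      (fun h => ENNReal.ofReal (‖h‖ ^ 2 * coherentGain σ ‖h * ((n : ℂ) + 1)‖)) h with hg
  have hgm (n : ℕ) : Measurable (g n) := by
    refine Measurable.indicator ?_ (measurableSet_le measurable_const (by fun_prop))
    unfold coherentGain
    fun_prop
  have hn0 (n : ℕ) : (n : ℂ) + 1 ≠ 0 := by exact_mod_cast n.succ_ne_zero
  have hlim (h : ℂ) : 1 / (σ : ℝ≥0∞) ^ 2 * ‖h‖ₑ ^ 2 ≤
      Filter.liminf (fun n => g n h) Filter.atTop := by
    rcases eq_or_ne h 0 with rfl | hh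
    · simp
    have hnorm : Filter.Tendsto (fun n : ℕ => ‖h * ((n : ℂ) + 1)‖) Filter.atTop Filter.atTop := by
      have e (n : ℕ) : ‖h * ((n : ℂ) + 1)‖ = ‖h‖ * ((n : ℝ) + 1) := by
        rw [norm_mul]
        congr 1
        exact_mod_cast Complex.norm_natCast (n + 1)
      simp_rw [e]
      exact (Filter.tendsto_atTop_add_const_right _ _
        tendsto_natCast_atTop_atTop).const_mul_atTop (norm_pos_iff.2 hh)
    have ht : Filter.Tendsto (fun n => g n h) Filter.atTop
        (nhds (ENNReal.ofReal (‖h‖ ^ 2 * (1 / (σ : ℝ) ^ 2)))) := by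
      refine (ENNReal.tendsto_ofReal
        (((tendsto_coherentGain hσ).comp hnorm).const_mul (‖h‖ ^ 2))).congr' ?_
      filter_upwards [hnorm.eventually_ge_atTop 4] with n hn
      simp only [hg]
      rw [Set.indicator_of_mem (by exact hn)]
      rfl
    rw [ht.liminf_eq, mul_comm (‖h‖ ^ 2), ENNReal.ofReal_mul (by positivity),
      ENNReal.ofReal_div_of_pos (by positivity), ENNReal.ofReal_pow (norm_nonneg _), ofReal_norm,
      ENNReal.ofReal_pow hσ'.le, ENNReal.ofReal_coe_nnreal, ENNReal.ofReal_one]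
  have hbound (n : ℕ) : ∫⁻ h, g n h ∂fadingLaw ≤ ⨆ (ξ : ℂ) (_ : ξ ≠ 0),
      coherentRelEntropy σ (fun h => radialRegion (coherentThreshold h ξ)) ξ / ‖ξ‖ₑ ^ 2 := by
    refine le_trans ?_ (le_iSup₂ (f := fun (ξ : ℂ) (_ : ξ ≠ 0) =>
      coherentRelEntropy σ (fun h => radialRegion (coherentThreshold h ξ)) ξ / ‖ξ‖ₑ ^ 2)
      ((n : ℂ) + 1) (hn0 n))
    set ξ := (n : ℂ) + 1 with hξ
    have hξ2 : ‖ξ‖ₑ ^ 2 ≠ 0 := by simpa using hn0 n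
    have hξ3 : ‖ξ‖ₑ ^ 2 ≠ ∞ := by finiteness
    rw [ENNReal.le_div_iff_mul_le (Or.inl hξ2) (Or.inl hξ3), ← lintegral_mul_const' _ _ hξ3]
    refine lintegral_mono fun h => ?_
    by_cases h4 : 4 ≤ ‖h * ξ‖
    · refine le_trans (le_of_eq ?_) (coherentGain_le_klDiv hσ h4)
      simp only [hg]
      rw [Set.indicator_of_mem (by exact h4), ← ofReal_norm, ← ENNReal.ofReal_pow (norm_nonneg _),
        ← ENNReal.ofReal_mul' (by positivity), norm_mul]
      congr 1
      ring
    · simp only [hg]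
      rw [Set.indicator_of_notMem (by exact h4), zero_mul]
      exact zero_le
  calc 1 / (σ : ℝ≥0∞) ^ 2 = ∫⁻ h, 1 / (σ : ℝ≥0∞) ^ 2 * ‖h‖ₑ ^ 2 ∂fadingLaw := by
        rw [lintegral_const_mul _ (by fun_prop), lintegral_norm_sq_fadingLaw, mul_one]
    _ ≤ ∫⁻ h, Filter.liminf (fun n => g n h) Filter.atTop ∂fadingLaw := lintegral_mono hlim
    _ ≤ Filter.liminf (fun n => ∫⁻ h, g n h ∂fadingLaw) Filter.atTop := lintegral_liminf_le hgm
    _ ≤ _ := Filter.liminf_le_of_frequently_le' (Filter.Frequently.of_forall hbound)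

end OneBit

theorem theorem1 (σ : ℝ≥0) (hσ : 0 < σ) :
    -- coherent case: the capacity per unit-energy, ...
    (OneBit.coherentCapacityPerUnitEnergy σ OneBit.coherentRules = 1 / (σ : ℝ≥0∞) ^ 2 ∧
      -- ... which is not reduced by allowing radial quantizers only, ...
      OneBit.coherentCapacityPerUnitEnergy σ OneBit.radialRules = 1 / (σ : ℝ≥0∞) ^ 2 ∧
      -- ... and is achieved by a radial quantizer with threshold depending on `H` and `ξ`
      ∃ T : ℂ → ℂ → ℝ, Measurable (fun p : ℂ × ℂ => T p.1 p.2) ∧ (∀ h ξ, 0 < T h ξ) ∧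
        (⨆ (ξ : ℂ) (_ : ξ ≠ 0),
          OneBit.coherentRelEntropy σ (fun h => OneBit.radialRegion (T h ξ)) ξ / ‖ξ‖ₑ ^ 2)
            = 1 / (σ : ℝ≥0∞) ^ 2) ∧
    -- noncoherent case: the strict inequality, and the quantitative bound
    (OneBit.noncoherentCapacityPerUnitEnergy σ < 1 / (σ : ℝ≥0∞) ^ 2 ∧
      OneBit.noncoherentCapacityPerUnitEnergy σ
        ≤ 1 / (ENNReal.ofReal (Real.exp 1) * (σ : ℝ≥0∞) ^ 2) ∧
      -- radial quantizers are optimal for every `ξ ≠ 0`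
      ∀ ξ : ℂ, ξ ≠ 0 → ∃ T : ℝ, 0 < T ∧ ∀ D : Set ℂ, MeasurableSet D →
        OneBit.noncoherentRelEntropy σ D ξ
          ≤ OneBit.noncoherentRelEntropy σ (OneBit.radialRegion T) ξ) := by

  have hsup : (⨆ (ξ : ℂ) (_ : ξ ≠ 0), OneBit.coherentRelEntropy σ
      (fun h => OneBit.radialRegion (OneBit.coherentThreshold h ξ)) ξ / ‖ξ‖ₑ ^ 2)
        = 1 / (σ : ℝ≥0∞) ^ 2 := by
    refine le_antisymm (iSup₂_le fun ξ _ => ENNReal.div_le_of_le_mul ?_)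
      (OneBit.le_iSup_coherentRelEntropy hσ)
    exact OneBit.coherentRelEntropy_le hσ
      (OneBit.radialRules_subset_coherentRules (OneBit.radialRule_coherentThreshold_mem ξ)) ξ
  have hradial : 1 / (σ : ℝ≥0∞) ^ 2 ≤
      OneBit.coherentCapacityPerUnitEnergy σ OneBit.radialRules := by
    rw [← hsup]
    exact iSup₂_le fun ξ hξ => OneBit.coherentRelEntropy_div_le hσ
      (OneBit.radialRule_coherentThreshold_mem ξ) hξ
  have hmono := OneBit.coherentCapacityPerUnitEnergy_mono σ
    OneBit.radialRules_subset_coherentRules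
  have hle := OneBit.coherentCapacityPerUnitEnergy_le hσ
  exact ⟨⟨le_antisymm hle (hradial.trans hmono), le_antisymm (hmono.trans hle) hradial,
      OneBit.coherentThreshold, OneBit.measurable_coherentThreshold,
      OneBit.coherentThreshold_pos, hsup⟩,
    OneBit.noncoherentCapacityPerUnitEnergy_lt hσ, OneBit.noncoherentCapacityPerUnitEnergy_le hσ,
    fun ξ _ => OneBit.exists_radialRegion_optimal hσ ξ⟩
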